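/- Fix an integer $k\ge 1$. Let $f$ be a probability density on a compact interval $[\underline m,\overline m]$ with law $F$, and $g$ a probability density on a compact interval $[\underline w,\overline w]$ with law $G$. In the first period there are $n$ men with types i.i.d. from $F$ and $n$ women with types i.i.d. from $G$, independently, with order statistics $m_1\le\dots\le m_n$ and $w_1\le\dots\le w_n$. In the second period $k$ new men with types i.i.d. from $F$ and $k$ new women with types i.i.d. from $G$ arrive, independently of each other and of the first period, and everyone present is matched assortatively (the $i$-th lowest of the $n+k$ men with the $i$-th lowest of the $n+k$ women). For the $j$-th lowest couple $(m_j,w_j)$, let $q_{j,n}$ be the ex-ante probability that, given all first-period types, the expected type of the second-period partner of man $m_j$ when everyone waits is strictly less than $w_j$, and likewise the expected type of the second-period partner of woman $w_j$ is strictly less than $m_j$ (so that both strictly prefer matching early with each other). For $r\ge 1$ let $b,c,\beta,\gamma$ be exponential random variables with mean $1$ and $a,\alpha$ be $\Gamma(r-1,1)$ random variables (with $\Gamma(0,1)$ the constant $0$), all six independent, and put $$\zeta_r=\Pr\big(2(\alpha+\beta)c>(2a+b)b,\ \ 2(a+b)\gamma>(2\alpha+\beta)\beta\big),$$ $$\eta_r=\Pr\big((2a+b)b>2(\alpha+\beta)c,\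 \ (2\alpha+\beta)\beta>2(a+b)\gamma\big).$$ 1. If $f$ and $g$ are continuous and positive at $\overline m$ and $\overline w$ respectively (continuity is one-sided, within the interval), then for every $r\ge1$ the unraveling probability of the $r$-th highest couple satisfies $\lim_{n\to\infty}q_{n+1-r,n}=\zeta_r>0$. 2. If $f$ and $g$ are continuous and positive at $\underline m$ and $\underline w$ respectively (again within the interval), then for every $r\ge1$ the unraveling probability of the $r$-th lowest couple satisfies $\lim_{n\to\infty}q_{r,n}=\eta_r>0$. 3. $\lim_{r\to\infty}\zeta_r=\tfrac14=\lim_{r\to\infty}\eta_r$. -/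

import Mathlib

open Set Filter Topology MeasureTheory

namespace MatchingMarket

noncomputable section

/-- The probability law on `[a, b]` with density `f`. -/
def typeLaw (f : ℝ → ℝ) (a b : ℝ) : Measure ℝ :=
  (volume.restrict (Icc a b)).withDensity (fun x => ENNReal.ofReal (f x))

/-- `f` is a probability density on the interval `[a, b]`. -/
structure IsDensityOn (f : ℝ → ℝ) (a b : ℝ) : Prop where
  measurable : Measurable f
  nonneg : ∀ x ∈ Icc a b, 0 ≤ f x
  lintegral_eq_one : ∫⁻ x in Icc a b, ENNReal.ofReal (f x) = 1

/-- The assortative matching of two sides with `N` agents each, with types `x` and `y`: the agent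
of the first side whose type is `i`-th in increasing order is matched with the agent of the second
side whose type is `i`-th in increasing order. (`Tuple.sort x` sends a rank to the agent of that
rank; equal types, which have probability zero below, are ranked by index.) -/
def assortativePartner {N : ℕ} (x y : Fin N → ℝ) : Equiv.Perm (Fin N) :=
  (Tuple.sort x).symm.trans (Tuple.sort y)

/-- The expected type of the second-period partner of agent `p`, whose side has first-period types
`x`, the other side having first-period types `y`, when all `n + n` first-period agents wait:
`k` new agents arrive on each side, with types drawn i.i.d. from `P` on the side of `p` and i.i.d.
from `Q` on the other side, and all `(n + k) + (n + k)` agents are then matched assortatively. -/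
def waitingPayoff (k : ℕ) (P Q : Measure ℝ) {n : ℕ} (x y : Fin n → ℝ) (p : Fin n) : ℝ :=
  ∫ e : (Fin k → ℝ) × (Fin k → ℝ),
    Fin.append y e.2
      (assortativePartner (Fin.append x e.1) (Fin.append y e.2) (Fin.castAdd k p))
    ∂((Measure.pi fun _ : Fin k => P).prod (Measure.pi fun _ : Fin k => Q))

/-- For realized first-period types `m` of the men and `w` of the women, both members of the couple
at rank `i` (ranks counted from `0`, the lowest) strictly prefer matching with each other now over
waiting for the second period, given that everyone else waits. -/
def CoupleWantsEarly (k : ℕ) (F G : Measure ℝ) {n : ℕ} (m w : Fin n → ℝ) (i : Fin n) : Prop :=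
  waitingPayoff k F G m w (Tuple.sort m i) < w (Tuple.sort w i) ∧
    waitingPayoff k G F w m (Tuple.sort w i) < m (Tuple.sort m i)

/-- The ex-ante probability `q_{j,n}` of unraveling of the couple of rank `j`, where `j = 1` is
the lowest and `j = n` the highest rank: the `n` men's types are i.i.d. from `F`, the `n` women's
types are i.i.d. from `G`, independently. (It is `0` when `j` is not in `{1, …, n}`.) -/
def unravelProb (k : ℕ) (F G : Measure ℝ) (j n : ℕ) : ℝ :=
  if h : 1 ≤ j ∧ j ≤ n then
    ((Measure.pi fun _ : Fin n => F).prod (Measure.pi fun _ : Fin n => G)).real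
      {t | CoupleWantsEarly k F G t.1 t.2 ⟨j - 1, by omega⟩}
  else 0

/-- The law `Γ(i, 1)`, with `Γ(0, 1)` the law of the constant `0`. -/
def gammaLaw (i : ℕ) : Measure ℝ :=
  if i = 0 then Measure.dirac 0 else ProbabilityTheory.gammaMeasure i 1

/-- The joint law of independent `Γ(r - 1, 1)`, `Exp(1)`, `Exp(1)` random variables. -/
def tripleLaw (r : ℕ) : Measure (ℝ × ℝ × ℝ) :=
  (gammaLaw (r - 1)).prod
    ((ProbabilityTheory.expMeasure 1).prod (ProbabilityTheory.expMeasure 1))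

/-- `ζ_r`, the probability that `2 (α + β) c > (2 a + b) b` and `2 (a + b) γ > (2 α + β) β`, for
independent triples `(a, b, c)` and `(α, β, γ)` with law `tripleLaw r`. -/
def zeta (r : ℕ) : ℝ :=
  ((tripleLaw r).prod (tripleLaw r)).real
    {((a, b, c), (α, β, γ)) : (ℝ × ℝ × ℝ) × (ℝ × ℝ × ℝ) |
      2 * (α + β) * c > (2 * a + b) * b ∧ 2 * (a + b) * γ > (2 * α + β) * β}

/-- `η_r`, the probability that `(2 a + b) b > 2 (α + β) c` and `(2 α + β) β > 2 (a + b) γ`, for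
independent triples `(a, b, c)` and `(α, β, γ)` with law `tripleLaw r`. -/
def eta (r : ℕ) : ℝ :=
  ((tripleLaw r).prod (tripleLaw r)).real
    {((a, b, c), (α, β, γ)) : (ℝ × ℝ × ℝ) × (ℝ × ℝ × ℝ) |
      (2 * a + b) * b > 2 * (α + β) * c ∧ (2 * α + β) * β > 2 * (a + b) * γ}

end

end MatchingMarket

/-!
Couples unravel according to the sign of the expected gain from waiting, and this gain has an
explicit leading term near the ends of the type distributions.

Consider the couple of rank `r` from the bottom, among `n` couples. The gaps between the types
around it are of order `1 / n`, so that a given entrant arrives below the couple with probability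
of order `1 / n`, and then shifts the partner by an amount of order `1 / n`: an entrant of one's
own side moves the partner up to the next type, an entrant of the other side moves the partner
down, to the previous type or to the entrant. Two such entrants have probability of order `n⁻²` and
contribute only `n⁻³`, whatever `k` is (`partnerType_eq_firstOrder`, `abs_waitingPayoff_sub_le`).
As the densities are continuous and positive at the endpoint, the entrants are uniform at this
scale, and for fixed scaled gaps the gain times `n²` tends to a positive multiple of `scaledGain`
of the gaps (`tendsto_waitingPayoff`). The partner is always among the `r + k` lowest types, so
only finitely many order statistics matter (`waitingPayoff_lowest`).

The lowest order statistics have an explicit joint density (`map_lowest_pi`), and after scaling the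
density of their gaps converges pointwise to that of independent exponential variables
(`IsDensityOn.tendsto_gapDensity`). The scaled gains vanish with probability zero
(`ae_gaps_scaledGain_ne_zero`), hence the events "both gains have the sign of `s`" converge almost
surely in the limit law. Pointwise convergence of the densities and of the events implies
convergence of the probabilities, by Fatou's lemma applied to the events and to their complements
(`tendsto_measureReal_withDensity`). This gives the limit `η_r` for the lowest couples.

Reflecting all types at `0` turns the highest couples into the lowest ones and reverses the signs
of the gains (`signProb_map_neg`), whence the limit `ζ_r` for the highest couples. It is for this
reason that both signs are treated together, by the parameter `s`.

Finally, as `r → ∞`, the law of large numbers makes `a` and `α` both asymptotic to `r`, and the two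
events become `s * (c - b) > 0` and `s * (γ - β) > 0`, which are independent of probability `1 / 2`
(`tendsto_limitProb`).
-/

namespace MatchingMarket

open ProbabilityTheory

open scoped ENNReal

/-! ### Exponential and Gamma laws, and the limit probabilities -/

instance isProbabilityMeasure_expMeasure_one : IsProbabilityMeasure (expMeasure 1) :=
  isProbabilityMeasure_expMeasure one_pos

instance isProbabilityMeasure_gammaLaw (i : ℕ) : IsProbabilityMeasure (gammaLaw i) := by
  unfold gammaLaw
  split_ifs with h
  · infer_instance
  · exact isProbabilityMeasure_gammaMeasure (by positivity) one_pos

instance isProbabilityMeasure_tripleLaw (r : ℕ) : IsProbabilityMeasure (tripleLaw r) := by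
  unfold tripleLaw
  infer_instance

theorem gammaLaw_one : gammaLaw 1 = expMeasure 1 := by simp [gammaLaw, expMeasure]

theorem measurable_gammaPDF (a r : ℝ) : Measurable (gammaPDF a r) :=
  (measurable_gammaPDFReal a r).ennreal_ofReal

instance nullSingletonClass_expMeasure_one : NullSingletonClass (expMeasure 1) := by
  unfold expMeasure gammaMeasure
  infer_instance

theorem gammaLaw_succ_conv_expMeasure (n : ℕ) :
    (gammaLaw (n + 1)).conv (expMeasure 1) = gammaLaw (n + 2) := by
  simp only [gammaLaw, expMeasure, gammaMeasure, if_neg (Nat.succ_ne_zero _)]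
  rw [conv_withDensity_eq_lconvolution (measurable_gammaPDF _ _) (measurable_gammaPDF _ _)]
  congr 1
  ext x
  rw [lconvolution_def]
  rcases lt_or_ge x 0 with hx | hx
  · rw [gammaPDF_of_neg hx]
    refine lintegral_eq_zero_of_ae_eq_zero (ae_of_all _ fun y => ?_)
    rcases lt_or_ge y 0 with hy | hy
    · simp [gammaPDF_of_neg hy]
    · simp [gammaPDF_of_neg (show -y + x < 0 by linarith)]
  · have key : ∀ y, gammaPDF (n + 1 : ℕ) 1 y * gammaPDF 1 1 (-y + x) =
        (Icc 0 x).indicator (fun y => ENNReal.ofReal (Real.exp (-x) / n.factorial * y ^ n)) y := by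
      intro y
      by_cases hy : y ∈ Icc 0 x
      · have h1 : 0 ≤ -y + x := by linarith [hy.2]
        rw [indicator_of_mem hy, gammaPDF_of_nonneg hy.1, gammaPDF_of_nonneg h1,
          ← ENNReal.ofReal_mul]
        · congr 1
          have : Real.exp (-x) = Real.exp (-y) * Real.exp (-(-y + x)) := by
            rw [← Real.exp_add]; ring_nf
          rw [this]
          push_cast
          simp [Real.Gamma_nat_eq_factorial]
          ring
        · have := Real.Gamma_pos_of_pos (show (0:ℝ) < (n + 1 : ℕ) by positivity)
          have := hy.1
          positivity
      · rw [indicator_of_notMem hy]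
        rcases lt_or_ge y 0 with h0 | h0
        · simp [gammaPDF_of_neg h0]
        · have : -y + x < 0 := by
            by_contra h
            exact hy ⟨h0, by linarith⟩
          simp [gammaPDF_of_neg this]
    simp_rw [key]
    rw [lintegral_indicator measurableSet_Icc, gammaPDF_of_nonneg hx,
      ← ofReal_integral_eq_lintegral_ofReal]
    · congr 1
      rw [integral_Icc_eq_integral_Ioc, ← intervalIntegral.integral_of_le hx,
        intervalIntegral.integral_const_mul, integral_pow]
      push_cast
      have : Real.Gamma ((n:ℝ) + 2) = (n + 1).factorial := by
        rw [← Real.Gamma_nat_eq_factorial]; push_cast; ring_nf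
      have h3 : ((n:ℝ) + 2 - 1) = ((n + 1 : ℕ) : ℝ) := by push_cast; ring
      rw [this, h3, Real.rpow_natCast, Nat.factorial_succ]
      push_cast
      have := Nat.factorial_pos n
      field_simp
      simp
    · exact (Continuous.continuousOn (by fun_prop)).integrableOn_compact isCompact_Icc
    · refine (ae_restrict_mem measurableSet_Icc).mono fun y hy => ?_
      have := hy.1
      simp only [Pi.zero_apply]
      positivity

theorem gammaLaw_conv_expMeasure (i : ℕ) :
    (gammaLaw i).conv (expMeasure 1) = gammaLaw (i + 1) := by
  cases i with
  | zero =>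
    rw [gammaLaw_one]
    simp only [gammaLaw, if_pos]
    exact Measure.dirac_zero_conv _
  | succ n => exact gammaLaw_succ_conv_expMeasure n

section Iid

variable {Ω ι : Type*} [MeasurableSpace Ω] {μ : Measure Ω} {X : ι → Ω → ℝ}

theorem map_sum_eq_gammaLaw (hi : iIndepFun X μ) (hX : ∀ i, Measurable (X i))
    (hl : ∀ i, μ.map (X i) = expMeasure 1) (s : Finset ι) :
    μ.map (fun ω => ∑ i ∈ s, X i ω) = gammaLaw s.card := by
  classical
  have := hi.isProbabilityMeasure
  induction s using Finset.induction_on with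
  | empty => simp [gammaLaw]
  | insert j s hj ih =>
    have hind := hi.indepFun_finsetSum_of_notMem hX hj
    have := hind.map_add_eq_map_conv_map (by fun_prop) (hX j)
    rw [Finset.card_insert_of_notMem hj, ← gammaLaw_conv_expMeasure, ← ih, ← hl j]
    convert this using 2
    · ext ω
      simp [Finset.sum_insert hj, add_comm]
    · congr 1
      ext ω
      simp

/-- A sum of `r - 1` independent exponentials together with two further ones has the law `tripleLaw
r`. -/
theorem map_triple_eq_tripleLaw (hi : iIndepFun X μ) (hX : ∀ i, Measurable (X i))
    (hl : ∀ i, μ.map (X i) = expMeasure 1) (s : Finset ι) {j l : ι} (hj : j ∉ s) (hl' : l ∉ s)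
    (hjl : j ≠ l) {r : ℕ} (hr : s.card = r - 1) :
    μ.map (fun ω => (∑ i ∈ s, X i ω, X j ω, X l ω)) = tripleLaw r := by
  classical
  have := hi.isProbabilityMeasure
  have h1 : IndepFun (fun ω (i : s) => X i ω) (fun ω (i : ({j, l} : Finset ι)) => X i ω) μ :=
    hi.indepFun_finset s {j, l} (by
      rw [Finset.disjoint_right]
      intro a ha
      rcases Finset.mem_insert.1 ha with rfl | ha
      · exact hj
      · rwa [Finset.mem_singleton.1 ha]) hX
  have h2 : IndepFun (fun ω => ∑ i ∈ s, X i ω) (fun ω => (X j ω, X l ω)) μ := by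
    have := h1.comp (φ := fun z : s → ℝ => ∑ i, z i)
      (ψ := fun z : ({j, l} : Finset ι) → ℝ => (z ⟨j, by simp⟩, z ⟨l, by simp⟩))
      (by fun_prop) (by fun_prop)
    convert this using 1
    · ext ω
      exact (Finset.sum_coe_sort s fun i => X i ω).symm
    · rfl
  have h3 := (indepFun_iff_map_prod_eq_prod_map_map
    (Finset.measurable_sum s fun i _ => hX i).aemeasurable
    ((hX j).prodMk (hX l)).aemeasurable).1 h2
  have h4 := (indepFun_iff_map_prod_eq_prod_map_map (hX j).aemeasurable
    (hX l).aemeasurable).1 (hi.indepFun hjl)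
  rw [h3, h4, map_sum_eq_gammaLaw hi hX hl, hl, hl, hr, tripleLaw]

end Iid

/-- The law of an infinite sequence of independent exponential random variables of mean one. -/
noncomputable def expSeq : Measure (ℕ → ℝ) := Measure.infinitePi fun _ => expMeasure 1

instance isProbabilityMeasure_expSeq : IsProbabilityMeasure expSeq := by
  unfold expSeq; infer_instance

theorem iIndepFun_eval_expSeq : iIndepFun (fun (i : ℕ) (ω : ℕ → ℝ) => ω i) expSeq :=
  iIndepFun_infinitePi (X := fun _ ω => ω) (fun _ => measurable_id)

theorem map_eval_expSeq (i : ℕ) : expSeq.map (fun ω => ω i) = expMeasure 1 :=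
  Measure.infinitePi_map_eval _ i

theorem map_expSeq_eq_tripleLaw (q : ℕ) :
    expSeq.map (fun ω => (∑ i ∈ Finset.range q, ω (i + 2), ω 0, ω 1)) = tripleLaw (q + 1) := by
  have := map_triple_eq_tripleLaw iIndepFun_eval_expSeq (fun i => measurable_pi_apply i)
    map_eval_expSeq ((Finset.range q).map (addRightEmbedding 2)) (j := 0) (l := 1)
    (by simp) (by simp) (by simp) (r := q + 1) (by simp)
  simpa using this

theorem integral_id_expMeasure : Integrable (fun x : ℝ => x) (expMeasure 1) ∧
    ∫ x, x ∂(expMeasure 1) = 1 := by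
  have hpdf : ∀ x : ℝ, x ∈ (Ioi (0:ℝ)) →
      gammaPDFReal 1 1 x • x = Real.exp (-x) * x ^ ((2:ℝ) - 1) := by
    intro x hx
    rw [gammaPDFReal, if_pos (le_of_lt hx)]
    norm_num
  have hind : (fun x : ℝ => gammaPDFReal 1 1 x • x) =
      (Ioi (0:ℝ)).indicator fun x => Real.exp (-x) * x ^ ((2:ℝ) - 1) := by
    ext x
    by_cases hx : x ∈ Ioi (0:ℝ)
    · rw [indicator_of_mem hx, hpdf x hx]
    · rw [indicator_of_notMem hx]
      rcases (not_lt.1 hx : x ≤ 0).lt_or_eq with h | h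
      · simp [gammaPDFReal, not_le.2 h]
      · simp [h]
  have hI := Real.GammaIntegral_convergent (s := 2) two_pos
  have hm : Measurable fun x => (gammaPDFReal 1 1 x).toNNReal :=
    (measurable_gammaPDFReal 1 1).real_toNNReal
  have hsm : (fun x : ℝ => (gammaPDFReal 1 1 x).toNNReal • x) =
      fun x => gammaPDFReal 1 1 x • x := by
    ext x
    rw [NNReal.smul_def, Real.coe_toNNReal _ (gammaPDFReal_nonneg one_pos one_pos x)]
  have hE : expMeasure 1 = volume.withDensity fun x => ((gammaPDFReal 1 1 x).toNNReal : ℝ≥0∞) := rfl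
  rw [hE, integrable_withDensity_iff_integrable_smul hm, integral_withDensity_eq_integral_smul hm,
    hsm, hind]
  refine ⟨(integrable_indicator_iff measurableSet_Ioi).2 hI, ?_⟩
  rw [integral_indicator measurableSet_Ioi, ← Real.Gamma_eq_integral two_pos, Real.Gamma_two]

theorem ae_tendsto_average_expSeq :
    ∀ᵐ ω : ℕ → ℝ ∂expSeq,
      Tendsto (fun q : ℕ => (∑ i ∈ Finset.range q, ω (i + 2)) / (q : ℝ)) atTop (𝓝 (1 : ℝ)) := by
  have hmap := map_eval_expSeq
  have h := strong_law_ae_real (μ := expSeq) (fun i (ω : ℕ → ℝ) => ω (i + 2)) ?_ ?_ ?_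
  · have : ∫ ω, ω (0 + 2) ∂expSeq = 1 := by
      rw [← integral_id_expMeasure.2, ← hmap (0 + 2), integral_map
        (measurable_pi_apply _).aemeasurable (by fun_prop)]
    rwa [this] at h
  · have := integral_id_expMeasure.1
    rw [← hmap (0 + 2)] at this
    exact (integrable_map_measure aestronglyMeasurable_id
      (measurable_pi_apply (0 + 2)).aemeasurable).1 this
  · intro i j hij
    exact iIndepFun_eval_expSeq.indepFun (by simpa using hij)
  · intro i
    exact ⟨(measurable_pi_apply _).aemeasurable, (measurable_pi_apply _).aemeasurable,
      by rw [hmap, hmap]⟩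

/-- For one side of the market let `(a, b, c)` consist of the scaled distance of the neighbour below
from the endpoint, and of the scaled gaps to the neighbours below and above. If `u` is this triple
on the side of an agent and `t` the triple on the side of the partners, the agent's expected gain
from waiting is, up to a positive scale, `scaledGain t u`: a rival entering below, of which there
are in proportion to `u.1 + u.2.1`, moves the partner up by `t.2.2`, while an entrant among the
partners moves the partner down by `t.2.1` if it lands below the neighbour, and on average by half
of that if it lands in the gap. -/
def scaledGain (t u : ℝ × ℝ × ℝ) : ℝ :=
  2 * (u.1 + u.2.1) * t.2.2 - (2 * t.1 + t.2.1) * t.2.1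

theorem measurable_scaledGain :
    Measurable fun z : (ℝ × ℝ × ℝ) × (ℝ × ℝ × ℝ) => scaledGain z.1 z.2 := by
  unfold scaledGain; fun_prop

/-- The probability that both scaled gains have the sign of `s`; it is `ζ_r` for `s = 1` and `η_r`
for `s = -1`. -/
noncomputable def limitProb (s : ℝ) (r : ℕ) : ℝ :=
  ((tripleLaw r).prod (tripleLaw r)).real
    {z | 0 < s * scaledGain z.1 z.2 ∧ 0 < s * scaledGain z.2 z.1}

theorem zeta_eq_limitProb : zeta = limitProb 1 := by
  ext r
  unfold zeta limitProb scaledGain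
  congr 1
  ext ⟨⟨a, b, c⟩, α, β, γ⟩
  simp [sub_pos]

theorem eta_eq_limitProb : eta = limitProb (-1) := by
  ext r
  unfold eta limitProb scaledGain
  congr 1
  ext ⟨⟨a, b, c⟩, α, β, γ⟩
  simp

theorem measurableSet_scaledGain (s : ℝ) : MeasurableSet
    {z : (ℝ × ℝ × ℝ) × (ℝ × ℝ × ℝ) | 0 < s * scaledGain z.1 z.2 ∧ 0 < s * scaledGain z.2 z.1} :=
  (measurableSet_lt measurable_const (measurable_scaledGain.const_mul s)).inter
    (measurableSet_lt measurable_const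
      ((measurable_scaledGain.comp measurable_swap).const_mul s))

theorem measure_prod_diagonal_real (P : Measure ℝ) [SFinite P] [NullSingletonClass P] :
    (P.prod P) {p : ℝ × ℝ | p.1 = p.2} = 0 := by
  rw [Measure.measure_prod_null (measurableSet_eq_fun measurable_fst measurable_snd)]
  refine ae_of_all _ fun x => ?_
  have : Prod.mk x ⁻¹' {p : ℝ × ℝ | p.1 = p.2} = {x} := by ext y; simp [eq_comm]
  simp only [this, measure_singleton, Pi.zero_apply]

theorem expMeasure_prod_lt {s : ℝ} (hs : s ≠ 0) :
    ((expMeasure 1).prod (expMeasure 1)).real {p : ℝ × ℝ | 0 < s * (p.2 - p.1)} = 1 / 2 := by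
  set M := (expMeasure 1).prod (expMeasure 1)
  have hm : ∀ t : ℝ, MeasurableSet {p : ℝ × ℝ | 0 < t * (p.2 - p.1)} := fun t =>
    measurableSet_lt measurable_const (by fun_prop)
  have h1 : M.real {p : ℝ × ℝ | 0 < s * (p.2 - p.1)} =
      M.real {p : ℝ × ℝ | 0 < -s * (p.2 - p.1)} := by
    have : M.map Prod.swap = M := Measure.prod_swap
    conv_lhs => rw [← this]
    rw [map_measureReal_apply measurable_swap (hm s)]
    congr 1
    ext p
    simp only [mem_preimage, mem_ofPred_eq, Prod.fst_swap, Prod.snd_swap]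
    ring_nf
  have h2 : M.real ({p : ℝ × ℝ | 0 < s * (p.2 - p.1)} ∪
      {p : ℝ × ℝ | 0 < -s * (p.2 - p.1)}) = 1 := by
    have : ∀ᵐ p ∂M, p ∈ ({p : ℝ × ℝ | 0 < s * (p.2 - p.1)} ∪
        {p : ℝ × ℝ | 0 < -s * (p.2 - p.1)}) := by
      have hd : ∀ᵐ p ∂M, p.1 ≠ p.2 := by
        rw [ae_iff]; simpa using measure_prod_diagonal_real (expMeasure 1)
      filter_upwards [hd] with p hp
      have : s * (p.2 - p.1) ≠ 0 := mul_ne_zero hs (sub_ne_zero.2 hp.symm)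
      rcases this.lt_or_gt with h | h
      · right
        simp only [mem_ofPred_eq]; linarith
      · left; exact h
    rw [measureReal_def, (mem_ae_iff_prob_eq_one ((hm _).union (hm _))).1 this]
    simp
  rw [measureReal_union _ (hm _), ← h1] at h2
  · linarith
  · rw [Set.disjoint_left]
    intro p hp hp'
    simp only [mem_ofPred_eq] at hp hp'
    linarith

theorem ae_eval_zero_ne_one_expSeq : ∀ᵐ ω ∂expSeq, ω 0 ≠ ω 1 := by
  have h := (indepFun_iff_map_prod_eq_prod_map_map (measurable_pi_apply 0).aemeasurable
    (measurable_pi_apply 1).aemeasurable).1 (iIndepFun_eval_expSeq.indepFun zero_ne_one)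
  rw [map_eval_expSeq, map_eval_expSeq] at h
  have hd : ∀ᵐ p ∂(expSeq.map fun ω => (ω 0, ω 1)), p.1 ≠ p.2 := by
    rw [h, ae_iff]; simpa using measure_prod_diagonal_real (expMeasure 1)
  exact ae_of_ae_map (f := fun ω : ℕ → ℝ => (ω 0, ω 1)) (by fun_prop) hd

theorem expSeq_lt {s : ℝ} (hs : s ≠ 0) : expSeq.real {ω | 0 < s * (ω 1 - ω 0)} = 1 / 2 := by
  have h := (indepFun_iff_map_prod_eq_prod_map_map (measurable_pi_apply 0).aemeasurable
    (measurable_pi_apply 1).aemeasurable).1 (iIndepFun_eval_expSeq.indepFun zero_ne_one)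
  rw [map_eval_expSeq, map_eval_expSeq] at h
  rw [← expMeasure_prod_lt hs, ← h, map_measureReal_apply (by fun_prop)
    (measurableSet_lt measurable_const (by fun_prop))]
  rfl

theorem eventually_pos_iff_of_tendsto {u : ℕ → ℝ} {l : ℝ} (hu : Tendsto u atTop (𝓝 l))
    (hl : l ≠ 0) : ∀ᶠ n in atTop, (0 < u n ↔ 0 < l) := by
  rcases hl.lt_or_gt with h | h
  · filter_upwards [hu.eventually (gt_mem_nhds h)] with n hn
    exact ⟨fun h' => absurd hn h'.not_gt, fun h' => absurd h h'.not_gt⟩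
  · filter_upwards [hu.eventually (lt_mem_nhds h)] with n hn
    exact ⟨fun _ => h, fun _ => hn⟩

/-- When `a` and `α` both grow like `q`, the scaled gain per `q` tends to `2 (c - b)`. -/
theorem tendsto_scaledGain_div {A A' : ℕ → ℝ} {b c b' : ℝ}
    (hA : Tendsto (fun q => A q / q) atTop (𝓝 1)) (hA' : Tendsto (fun q => A' q / q) atTop (𝓝 1))
    {c' : ℝ} :
    Tendsto (fun q : ℕ => scaledGain (A q, b, c) (A' q, b', c') / q) atTop (𝓝 (2 * (c - b))) := by
  have h0 : Tendsto (fun q : ℕ => (q:ℝ)⁻¹) atTop (𝓝 0) := tendsto_inv_atTop_nhds_zero_nat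
  have := (((hA'.add (h0.const_mul b')).const_mul 2).mul_const c).sub
    (((hA.const_mul 2).add (h0.const_mul b)).mul_const b)
  refine (this.congr fun q => ?_).trans (le_of_eq ?_)
  · simp only [scaledGain]
    ring
  · congr 1; ring

/-- As `r → ∞` the sums `a` and `α` are both `r (1 + o(1))` by the law of large numbers, so both
events reduce to the comparison of two independent exponentials. -/
theorem tendsto_limitProb {s : ℝ} (hs : s ≠ 0) : Tendsto (limitProb s) atTop (𝓝 (1 / 4)) := by
  rw [← tendsto_add_atTop_iff_nat 1]
  set T : ℕ → (ℕ → ℝ) → ℝ × ℝ × ℝ := fun q ω => (∑ i ∈ Finset.range q, ω (i + 2), ω 0, ω 1)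
  have hT : ∀ q, Measurable (T q) := fun q => by fun_prop
  have hlaw : ∀ q, ((expSeq.prod expSeq).map (Prod.map (T q) (T q))) =
      (tripleLaw (q + 1)).prod (tripleLaw (q + 1)) := fun q => by
    rw [← Measure.map_prod_map _ _ (hT q) (hT q), map_expSeq_eq_tripleLaw]
  set B : Set ((ℕ → ℝ) × (ℕ → ℝ)) := {ω | 0 < s * (ω 1 - ω 0)} ×ˢ {ω | 0 < s * (ω 1 - ω 0)}
  have hBm : MeasurableSet {ω : ℕ → ℝ | 0 < s * (ω 1 - ω 0)} :=
    measurableSet_lt measurable_const (by fun_prop)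
  have hB : (expSeq.prod expSeq).real B = 1 / 4 := by
    rw [measureReal_prod_prod, expSeq_lt hs]; norm_num
  have hlim : ∀ q, limitProb s (q + 1) = (expSeq.prod expSeq).real
      (Prod.map (T q) (T q) ⁻¹' {z | 0 < s * scaledGain z.1 z.2 ∧ 0 < s * scaledGain z.2 z.1}) := by
    intro q
    rw [limitProb, ← hlaw, map_measureReal_apply (by fun_prop) (measurableSet_scaledGain s)]
  simp_rw [hlim]
  rw [← hB]
  refine (ENNReal.tendsto_toReal (measure_ne_top _ _)).comp
    (tendsto_measure_of_ae_tendsto_indicator_of_isFiniteMeasure atTop (hBm.prod hBm)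
      (fun q => (measurableSet_scaledGain s).preimage (by fun_prop)) ?_)
  have h1 := (Measure.quasiMeasurePreserving_fst (μ := expSeq) (ν := expSeq)).ae
    (ae_tendsto_average_expSeq.and ae_eval_zero_ne_one_expSeq)
  have h2 := (Measure.quasiMeasurePreserving_snd (μ := expSeq) (ν := expSeq)).ae
    (ae_tendsto_average_expSeq.and ae_eval_zero_ne_one_expSeq)
  filter_upwards [h1, h2] with ω ⟨ha, hne⟩ ⟨hα, hne'⟩
  have e1 := eventually_pos_iff_of_tendsto ((tendsto_scaledGain_div ha hα (b := ω.1 0) (c := ω.1 1)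
    (b' := ω.2 0) (c' := ω.2 1)).const_mul s)
    (mul_ne_zero hs (mul_ne_zero two_ne_zero (sub_ne_zero.2 hne.symm)))
  have e2 := eventually_pos_iff_of_tendsto ((tendsto_scaledGain_div hα ha (b := ω.2 0) (c := ω.2 1)
    (b' := ω.1 0) (c' := ω.1 1)).const_mul s)
    (mul_ne_zero hs (mul_ne_zero two_ne_zero (sub_ne_zero.2 hne'.symm)))
  filter_upwards [e1, e2, eventually_gt_atTop 0] with q h1 h2 hq
  have hq' : (0:ℝ) < q := by exact_mod_cast hq
  have key : ∀ x : ℝ, 0 < s * (x / q) ↔ 0 < s * x := fun x => by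
    rw [← mul_div_assoc]; exact ⟨fun h => by simpa [hq'] using h, fun h => div_pos h hq'⟩
  have key2 : ∀ x : ℝ, 0 < s * (2 * x) ↔ 0 < s * x := fun x => by
    constructor <;> intro h <;> linarith
  rw [key, key2] at h1 h2
  simp only [B, T, mem_preimage, mem_ofPred_eq, Prod.map_fst, Prod.map_snd, mem_prod]
  rw [h1, h2]

theorem expMeasure_Ioo_pos {x y : ℝ} (hx : 0 ≤ x) (hxy : x < y) : 0 < expMeasure 1 (Ioo x y) := by
  rw [expMeasure, gammaMeasure, withDensity_apply _ measurableSet_Ioo,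
    setLIntegral_pos_iff (measurable_gammaPDF 1 1)]
  have : Function.support (gammaPDF 1 1) ∩ Ioo x y = Ioo x y := by
    refine inter_eq_right.2 fun z hz => ?_
    have := gammaPDFReal_pos one_pos one_pos (lt_of_le_of_lt hx hz.1)
    simpa [gammaPDF] using this
  rw [this]
  simpa using hxy

theorem exists_gammaLaw_Icc_pos (i : ℕ) : ∃ M : ℝ, 0 ≤ M ∧ 0 < gammaLaw i (Icc 0 M) := by
  have h0 : gammaLaw i (Ici 0) = 1 := by
    rw [gammaLaw]
    split_ifs with h
    · simp
    · have := isProbabilityMeasure_gammaMeasure (a := i) (r := 1) (by positivity) one_pos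
      rw [prob_compl_eq_zero_iff measurableSet_Ici |>.symm, compl_Ici, gammaMeasure,
        withDensity_apply _ measurableSet_Iio]
      exact lintegral_gammaPDF_of_nonpos le_rfl
  by_contra! hcon
  have : Ici (0:ℝ) = ⋃ n : ℕ, Icc 0 (n:ℝ) := by
    ext x
    simp only [mem_Ici, mem_iUnion, mem_Icc]
    exact ⟨fun h => (exists_nat_ge x).imp fun n hn => ⟨h, hn⟩, fun ⟨n, h⟩ => h.1⟩
  rw [this, measure_iUnion_null fun n : ℕ => nonpos_iff_eq_zero.1 (hcon n (by positivity))] at h0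
  exact zero_ne_one h0

/-- On a box of positive probability, with `a`, `α` bounded, `b`, `β` bounded away from `0`, and
`c`, `γ` both large (`s = 1`) or both small (`s = -1`), both scaled gains have the sign of `s`. -/
theorem limitProb_pos {s : ℝ} (hs : s = 1 ∨ s = -1) (r : ℕ) : 0 < limitProb s r := by
  obtain ⟨M, hM, hpos⟩ := exists_gammaLaw_Icc_pos (r - 1)
  obtain ⟨x, y, hx, hxy, hsub⟩ : ∃ x y : ℝ, 0 ≤ x ∧ x < y ∧
      ∀ a ∈ Icc 0 M, ∀ b ∈ Ioo (1/2 : ℝ) 1, ∀ c ∈ Ioo x y, ∀ a' ∈ Icc 0 M, ∀ b' ∈ Ioo (1/2 : ℝ) 1,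
        ∀ c', 0 < s * scaledGain (a, b, c) (a', b', c') := by
    rcases hs with rfl | rfl
    · refine ⟨2 * M + 1, 2 * M + 2, by positivity, by linarith, ?_⟩
      rintro a ⟨ha, ha'⟩ b ⟨hb, hb'⟩ c ⟨hc, hc'⟩ a' ⟨ha1, ha1'⟩ b' ⟨hb1, hb1'⟩ c'
      simp only [scaledGain]
      have h1 : 1 * c ≤ 2 * (a' + b') * c := by
        apply mul_le_mul_of_nonneg_right <;> linarith
      have h2 : (2 * a + b) * b ≤ (2 * M + 1) * 1 := by
        apply mul_le_mul <;> linarith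
      linarith
    · refine ⟨0, 1 / (8 * (M + 1)), le_rfl, by positivity, ?_⟩
      rintro a ⟨ha, ha'⟩ b ⟨hb, hb'⟩ c ⟨hc, hc'⟩ a' ⟨ha1, ha1'⟩ b' ⟨hb1, hb1'⟩ c'
      simp only [scaledGain]
      have h1 : 2 * (a' + b') * c ≤ 2 * (M + 1) * c := by
        apply mul_le_mul_of_nonneg_right <;> linarith
      have h2 : (1 / 2) * (1 / 2) ≤ (2 * a + b) * b := by
        apply mul_le_mul <;> linarith
      rw [lt_div_iff₀ (by positivity)] at hc'
      nlinarith
  set T : Set (ℝ × ℝ × ℝ) := Icc 0 M ×ˢ (Ioo (1/2 : ℝ) 1 ×ˢ Ioo x y)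
  have hT : 0 < tripleLaw r T := by
    rw [tripleLaw, Measure.prod_prod, Measure.prod_prod]
    exact ENNReal.mul_pos hpos.ne' (ENNReal.mul_pos (expMeasure_Ioo_pos (by norm_num)
      (by norm_num)).ne' (expMeasure_Ioo_pos hx hxy).ne').ne'
  rw [limitProb, measureReal_def, ENNReal.toReal_pos_iff]
  refine ⟨lt_of_lt_of_le (ENNReal.mul_pos hT.ne' hT.ne') ?_, measure_lt_top _ _⟩
  rw [← Measure.prod_prod]
  refine measure_mono ?_
  rintro ⟨⟨a, b, c⟩, a', b', c'⟩ ⟨⟨h1, h2, h3⟩, h4, h5, h6⟩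
  exact ⟨hsub _ h1 _ h2 _ h3 _ h4 _ h5 _, hsub _ h4 _ h5 _ h6 _ h1 _ h2 _⟩

/-! ### Ranks, partners and payoffs -/

section Count

variable {ι : Type*} [Fintype ι]

/-- The number of entries of `x` below `c`. -/
noncomputable def countLT (x : ι → ℝ) (c : ℝ) : ℕ := (Finset.univ.filter fun i => x i < c).card

/-- The number of entries of `x` that are at most `c`. -/
noncomputable def countLE (x : ι → ℝ) (c : ℝ) : ℕ := (Finset.univ.filter fun i => x i ≤ c).card

theorem countLT_append {n k : ℕ} (x : Fin n → ℝ) (e : Fin k → ℝ) (c : ℝ) :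
    countLT (Fin.append x e) c = countLT x c + countLT e c := by
  simp only [countLT, Finset.card_filter, Fin.sum_univ_add, Fin.append_left, Fin.append_right]

theorem countLE_append {n k : ℕ} (x : Fin n → ℝ) (e : Fin k → ℝ) (c : ℝ) :
    countLE (Fin.append x e) c = countLE x c + countLE e c := by
  simp only [countLE, Finset.card_filter, Fin.sum_univ_add, Fin.append_left, Fin.append_right]

theorem countLT_le (x : ι → ℝ) (c : ℝ) : countLT x c ≤ Fintype.card ι := Finset.card_le_univ _

theorem countLE_le (x : ι → ℝ) (c : ℝ) : countLE x c ≤ Fintype.card ι := Finset.card_le_univ _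

/-- The type of rank `q`, counted from `0`, is at most `t` when more than `q` types are. -/
theorem lt_countLE_iff {N : ℕ} (y : Fin N → ℝ) (q : Fin N) (t : ℝ) :
    (q : ℕ) < countLE y t ↔ y (Tuple.sort y q) ≤ t := by
  rw [← Function.comp_apply (f := y), ← Tuple.lt_card_le_iff_apply_le_of_monotone
    (Tuple.monotone_sort y)]
  have : countLE y t = (Finset.univ.filter fun i => (y ∘ Tuple.sort y) i ≤ t).card := by
    rw [countLE]
    symm
    refine Finset.card_equiv (Tuple.sort y) fun i => ?_
    simp
  rw [this]

/-- The rank of an agent without ties is the number of lower types. -/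
theorem sort_symm_eq_countLT {N : ℕ} (x : Fin N → ℝ) (p : Fin N) (hp : ∀ i, x i = x p → i = p) :
    (((Tuple.sort x).symm p : Fin N) : ℕ) = countLT x (x p) := by
  set q := (Tuple.sort x).symm p with hq
  have hqp : Tuple.sort x q = p := by simp [hq]
  have hm := Tuple.monotone_sort x
  rw [countLT, ← Fin.card_Iio q]
  refine Finset.card_equiv (Tuple.sort x) fun j => ?_
  simp only [Finset.mem_Iio, Finset.mem_filter, Finset.mem_univ, true_and]
  constructor
  · intro hj
    have h1 : x (Tuple.sort x j) ≤ x (Tuple.sort x q) := hm hj.le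
    rw [hqp] at h1
    refine lt_of_le_of_ne h1 fun h => hj.ne ?_
    apply (Tuple.sort x).injective
    rw [hqp, hp _ h]
  · intro hj
    by_contra h
    have h1 : x (Tuple.sort x q) ≤ x (Tuple.sort x j) := hm (not_lt.1 h)
    rw [hqp] at h1
    exact absurd hj h1.not_gt

theorem countLT_sort {N : ℕ} {x : Fin N → ℝ} (hx : Function.Injective x) (q : Fin N) :
    countLT x (x (Tuple.sort x q)) = q := by
  rw [← sort_symm_eq_countLT x _ fun i h => hx h, Equiv.symm_apply_apply]

theorem sort_eq_refl {N : ℕ} {x : Fin N → ℝ} (hx : Monotone x) : Tuple.sort x = Equiv.refl _ :=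
  Tuple.sort_eq_refl_iff_monotone.2 hx

theorem countLT_strictMono {N : ℕ} {x : Fin N → ℝ} (hx : StrictMono x) (q : Fin N) :
    countLT x (x q) = q := by
  simpa [sort_eq_refl hx.monotone] using countLT_sort hx.injective q

end Count

section Partner

/-- The type of the assortative partner of agent `p` of the first side. -/
noncomputable def partnerType {N : ℕ} (x y : Fin N → ℝ) (p : Fin N) : ℝ :=
  y (assortativePartner x y p)

theorem partnerType_le_iff {N : ℕ} {x : Fin N → ℝ} (y : Fin N → ℝ) {p : Fin N}
    (hp : ∀ i, x i = x p → i = p) (t : ℝ) :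
    partnerType x y p ≤ t ↔ countLT x (x p) < countLE y t := by
  rw [← sort_symm_eq_countLT x p hp, lt_countLE_iff]
  rfl

/-- The partner in the second period of agent `p`, when `e` and `e'` are the types of the new
agents: the rank of `p` moves up by the number of new agents of lower type on the same side. -/
theorem partnerType_append_le_iff {n k : ℕ} {x : Fin n → ℝ} (y : Fin n → ℝ) {p : Fin n}
    {e : Fin k → ℝ} (e' : Fin k → ℝ) (hp : ∀ i, x i = x p → i = p) (he : ∀ j, e j ≠ x p) (t : ℝ) :
    partnerType (Fin.append x e) (Fin.append y e') (Fin.castAdd k p) ≤ t ↔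
      countLT x (x p) + countLT e (x p) < countLE y t + countLE e' t := by
  rw [partnerType_le_iff, Fin.append_left, countLT_append, countLE_append]
  intro i
  refine Fin.addCases (fun i h => ?_) (fun j h => ?_) i
  · simp only [Fin.append_left] at h
    rw [hp i h]
  · simp only [Fin.append_left, Fin.append_right] at h
    exact absurd h (he j)

theorem waitingPayoff_eq (k : ℕ) (P Q : Measure ℝ) {n : ℕ} (x y : Fin n → ℝ) (p : Fin n) :
    waitingPayoff k P Q x y p = ∫ e : (Fin k → ℝ) × (Fin k → ℝ),
      partnerType (Fin.append x e.1) (Fin.append y e.2) (Fin.castAdd k p)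
      ∂((Measure.pi fun _ : Fin k => P).prod (Measure.pi fun _ : Fin k => Q)) := rfl

/-- The `R` lowest types of a sample, in increasing order. -/
noncomputable def lowest {R m : ℕ} (x : Fin (R + m) → ℝ) : Fin R → ℝ :=
  fun i => x (Tuple.sort x (Fin.castAdd m i))

theorem strictMono_sort {N : ℕ} {x : Fin N → ℝ} (hx : Function.Injective x) :
    StrictMono (x ∘ Tuple.sort x) :=
  (Tuple.monotone_sort x).strictMono_of_injective (hx.comp (Tuple.sort x).injective)

theorem strictMono_lowest {R m : ℕ} {x : Fin (R + m) → ℝ} (hx : Function.Injective x) :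
    StrictMono (lowest x) :=
  (strictMono_sort hx).comp (Fin.strictMono_castAdd m)

theorem countLE_lowest {R m : ℕ} (y : Fin (R + m) → ℝ) (t : ℝ) :
    countLE (lowest y) t = min (countLE y t) R := by
  have hmono : Monotone (lowest y) :=
    (Tuple.monotone_sort y).comp (Fin.strictMono_castAdd m).monotone
  have key : ∀ q < R, q < countLE (lowest y) t ↔ q < countLE y t := by
    intro q hq
    have h1 := lt_countLE_iff (lowest y) ⟨q, hq⟩ t
    have h2 := lt_countLE_iff y (Fin.castAdd m ⟨q, hq⟩) t
    rw [sort_eq_refl hmono] at h1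
    exact h1.trans h2.symm
  have h1 : countLE (lowest y) t ≤ R := by simpa using countLE_le (lowest y) t
  refine eq_of_forall_lt_iff fun q => ?_
  rw [lt_min_iff]
  constructor
  · intro h
    have := h.trans_le h1
    exact ⟨(key q this).1 h, this⟩
  · exact fun h => (key q h.2).2 h.1

theorem ae_pi_forall_ne (P : Measure ℝ) [IsProbabilityMeasure P] [NullSingletonClass P] (k : ℕ)
    (c : ℝ) : ∀ᵐ e ∂(Measure.pi fun _ : Fin k => P), ∀ j, e j ≠ c :=
  ae_all_iff.2 fun j => Measure.ae_eval_ne (μ := fun _ : Fin k => P) j c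

/-- With `k` new agents on each side, the second-period partner of the agent of rank `p` is among
the `p + k + 1` lowest types, so that discarding all but the lowest `R > p + k` couples does not
change the payoff. -/
theorem waitingPayoff_lowest (k : ℕ) (P Q : Measure ℝ) [IsProbabilityMeasure P]
    [IsProbabilityMeasure Q] [NullSingletonClass P] {R m : ℕ} {x : Fin (R + m) → ℝ}
    (y : Fin (R + m) → ℝ) (hx : Function.Injective x) (p : Fin R) (hp : (p : ℕ) + k < R) :
    waitingPayoff k P Q x y (Tuple.sort x (Fin.castAdd m p)) =
      waitingPayoff k P Q (lowest x) (lowest y) p := by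
  rw [waitingPayoff_eq, waitingPayoff_eq]
  refine integral_congr_ae ?_
  filter_upwards [Measure.quasiMeasurePreserving_fst.ae (ae_pi_forall_ne P k (lowest x p))]
    with e he
  refine eq_of_forall_ge_iff fun t => ?_
  rw [partnerType_append_le_iff y e.2 (fun i h => hx h) he,
    partnerType_append_le_iff (lowest y) e.2 (fun i h => (strictMono_lowest hx).injective h) he,
    countLT_strictMono (strictMono_lowest hx), countLT_sort hx, countLE_lowest]
  have h1 : countLT e.1 (lowest x p) ≤ k := by simpa using countLT_le e.1 (lowest x p)
  have h2 : x (Tuple.sort x (Fin.castAdd m p)) = lowest x p := rfl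
  rw [h2, Fin.val_castAdd]
  omega

end Partner

section Measurability

theorem measurableSet_sort_eq {N : ℕ} (σ : Equiv.Perm (Fin N)) :
    MeasurableSet {x : Fin N → ℝ | Tuple.sort x = σ} := by
  have : {x : Fin N → ℝ | Tuple.sort x = σ} = {x | (∀ i j, i ≤ j → x (σ i) ≤ x (σ j)) ∧
      ∀ i j, i < j → x (σ i) = x (σ j) → σ i < σ j} := by
    ext x
    rw [mem_ofPred_eq, eq_comm, Tuple.eq_sort_iff]
    rfl
  rw [this]
  measurability

/-- The partner is a finite sum over the possible sorting permutations. -/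
theorem measurable_partnerType {N : ℕ} (p : Fin N) :
    Measurable fun z : (Fin N → ℝ) × (Fin N → ℝ) => partnerType z.1 z.2 p := by
  have : (fun z : (Fin N → ℝ) × (Fin N → ℝ) => partnerType z.1 z.2 p) = fun z =>
      ∑ σ : Equiv.Perm (Fin N), ∑ τ : Equiv.Perm (Fin N),
        if Tuple.sort z.1 = σ ∧ Tuple.sort z.2 = τ then z.2 (τ (σ.symm p)) else 0 := by
    ext z
    rw [Finset.sum_eq_single (Tuple.sort z.1), Finset.sum_eq_single (Tuple.sort z.2)]
    · simp [partnerType, assortativePartner]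
    · intro τ _ h
      simp [h.symm]
    · simp
    · intro σ _ h
      simp [h.symm]
    · simp
  rw [this]
  refine Finset.measurable_sum _ fun σ _ => Finset.measurable_sum _ fun τ _ => ?_
  refine Measurable.ite ?_ (by fun_prop) measurable_const
  exact ((measurableSet_sort_eq σ).preimage measurable_fst).inter
    ((measurableSet_sort_eq τ).preimage measurable_snd)

theorem measurable_append {α : Type*} [MeasurableSpace α] {n k : ℕ} {u : α → Fin n → ℝ}
    {v : α → Fin k → ℝ} (hu : Measurable u) (hv : Measurable v) :
    Measurable fun a => Fin.append (u a) (v a) := by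
  refine measurable_pi_lambda _ fun i => ?_
  refine Fin.addCases (fun i => ?_) (fun i => ?_) i
  · simp only [Fin.append_left]; fun_prop
  · simp only [Fin.append_right]; fun_prop

theorem measurable_waitingPayoff (k : ℕ) (P Q : Measure ℝ) [IsProbabilityMeasure P]
    [IsProbabilityMeasure Q] {n : ℕ} (p : Fin n) :
    Measurable fun z : (Fin n → ℝ) × (Fin n → ℝ) => waitingPayoff k P Q z.1 z.2 p := by
  simp_rw [waitingPayoff_eq]
  refine (StronglyMeasurable.integral_prod_right
    (f := fun (z : (Fin n → ℝ) × (Fin n → ℝ)) (e : (Fin k → ℝ) × (Fin k → ℝ)) =>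
      partnerType (Fin.append z.1 e.1) (Fin.append z.2 e.2) (Fin.castAdd k p))
      (Measurable.stronglyMeasurable ?_)).measurable
  exact (measurable_partnerType _).comp ((measurable_append (by fun_prop) (by fun_prop)).prodMk
    (measurable_append (by fun_prop) (by fun_prop)))

end Measurability

section Injective

theorem ae_pi_injective (P : Measure ℝ) [IsProbabilityMeasure P] [NullSingletonClass P] (n : ℕ) :
    ∀ᵐ x ∂(Measure.pi fun _ : Fin n => P), Function.Injective x := by
  have h : ∀ i j : Fin n, i ≠ j → ∀ᵐ x ∂(Measure.pi fun _ : Fin n => P), x i ≠ x j := by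
    intro i j hij
    have h1 := (iIndepFun_pi (μ := fun _ : Fin n => P) (X := fun _ x => x)
      (fun _ => aemeasurable_id)).indepFun hij
    have h2 := (indepFun_iff_map_prod_eq_prod_map_map (measurable_pi_apply i).aemeasurable
      (measurable_pi_apply j).aemeasurable).1 h1
    have h3 := (measurePreserving_eval (fun _ : Fin n => P) i).map_eq
    have h4 := (measurePreserving_eval (fun _ : Fin n => P) j).map_eq
    have h5 : (Measure.pi fun _ : Fin n => P).map (fun x => (x i, x j)) = P.prod P := by
      rw [h2]
      exact congr_arg₂ _ h3 h4
    have hd : ∀ᵐ p ∂((Measure.pi fun _ : Fin n => P).map fun x => (x i, x j)), p.1 ≠ p.2 := by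
      rw [h5, ae_iff]; simpa using measure_prod_diagonal_real P
    exact ae_of_ae_map (f := fun x : Fin n → ℝ => (x i, x j)) (by fun_prop) hd
  have h' : ∀ᵐ x ∂(Measure.pi fun _ : Fin n => P), ∀ i j : Fin n, i ≠ j → x i ≠ x j := by
    refine ae_all_iff.2 fun i => ae_all_iff.2 fun j => ?_
    by_cases hij : i = j
    · simp [hij]
    · filter_upwards [h i j hij] with x hx _ using hx
  filter_upwards [h'] with x hx i j hij
  by_contra hne
  exact hx i j hne hij

theorem ae_append_injective (P : Measure ℝ) [IsProbabilityMeasure P] [NullSingletonClass P]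
    {n : ℕ} (k : ℕ) {x : Fin n → ℝ} (hx : Function.Injective x) :
    ∀ᵐ e ∂(Measure.pi fun _ : Fin k => P), Function.Injective (Fin.append x e) := by
  have h : ∀ᵐ e ∂(Measure.pi fun _ : Fin k => P), ∀ i, ∀ j, e j ≠ x i :=
    ae_all_iff.2 fun i => ae_pi_forall_ne P k (x i)
  filter_upwards [ae_pi_injective P k, h] with e he hne
  exact Fin.append_injective_iff.2 ⟨hx, he, fun i j => (hne i j).symm⟩

end Injective

section Reflection

theorem sort_neg {N : ℕ} {x : Fin N → ℝ} (hx : Function.Injective x) :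
    Tuple.sort (-x) = Fin.revPerm.trans (Tuple.sort x) := by
  symm
  rw [Tuple.eq_sort_iff]
  refine ⟨fun i j hij => ?_, fun i j hij h => ?_⟩
  · have := Tuple.monotone_sort x (Fin.rev_le_rev.2 hij)
    simpa using this
  · have := (Fin.revPerm.trans (Tuple.sort x)).injective (hx (neg_injective h))
    exact absurd this hij.ne

theorem assortativePartner_neg {N : ℕ} {x y : Fin N → ℝ} (hx : Function.Injective x)
    (hy : Function.Injective y) : assortativePartner (-x) (-y) = assortativePartner x y := by
  rw [assortativePartner, sort_neg hx, sort_neg hy]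
  ext p
  simp [assortativePartner]

theorem append_neg {n k : ℕ} (x : Fin n → ℝ) (e : Fin k → ℝ) :
    Fin.append (-x) (-e) = -Fin.append x e := by
  ext i
  refine Fin.addCases (fun i => ?_) (fun i => ?_) i <;> simp

theorem pi_map_neg (P : Measure ℝ) [IsProbabilityMeasure P] (n : ℕ) :
    MeasurePreserving (fun x : Fin n → ℝ => -x) (Measure.pi fun _ => P)
      (Measure.pi fun _ => P.map Neg.neg) := by
  have : IsProbabilityMeasure (P.map Neg.neg) := Measure.isProbabilityMeasure_map (by fun_prop)
  exact measurePreserving_pi (fun _ : Fin n => P) (fun _ => P.map Neg.neg)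
    (f := fun _ t => -t) fun _ => (measurable_neg (G := ℝ)).measurePreserving P

theorem waitingPayoff_neg (k : ℕ) (P Q : Measure ℝ) [IsProbabilityMeasure P]
    [IsProbabilityMeasure Q] [NullSingletonClass P] [NullSingletonClass Q] {n : ℕ} {x y : Fin n → ℝ}
    (hx : Function.Injective x) (hy : Function.Injective y) (p : Fin n) :
    waitingPayoff k (P.map Neg.neg) (Q.map Neg.neg) (-x) (-y) p = -waitingPayoff k P Q x y p := by
  have : IsProbabilityMeasure (P.map Neg.neg) := Measure.isProbabilityMeasure_map (by fun_prop)
  have : IsProbabilityMeasure (Q.map Neg.neg) := Measure.isProbabilityMeasure_map (by fun_prop)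
  have hmp := (pi_map_neg P k).prod (pi_map_neg Q k)
  rw [waitingPayoff_eq, waitingPayoff_eq, ← integral_neg, ← hmp.map_eq, integral_map
    hmp.measurable.aemeasurable]
  · refine integral_congr_ae ?_
    filter_upwards [Measure.quasiMeasurePreserving_fst.ae (ae_append_injective P k hx),
      Measure.quasiMeasurePreserving_snd.ae (ae_append_injective Q k hy)] with e h1 h2
    simp only [Prod.map_fst, Prod.map_snd, append_neg, partnerType, assortativePartner_neg h1 h2]
    rfl
  · exact ((measurable_partnerType _).comp ((measurable_append (by fun_prop) (by fun_prop)).prodMk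
      (measurable_append (by fun_prop) (by fun_prop)))).aestronglyMeasurable

end Reflection

/-! ### The joint law of the lowest types -/

section OrderStatistics

theorem measurableSet_strictMono (n : ℕ) : MeasurableSet {x : Fin n → ℝ | StrictMono x} := by
  have : {x : Fin n → ℝ | StrictMono x} = {x | ∀ i j, i < j → x i < x j} := rfl
  rw [this]
  measurability

/-- The density, with respect to the i.i.d. law of `N + 1` types, of the `N + 1` lowest among
`N + 1 + m` types: the remaining `m` types have to lie above, and any injective choice of agents may
be the lowest ones. -/
noncomputable def lowestDensity (P : Measure ℝ) (N m : ℕ) (z : Fin (N + 1) → ℝ) : ℝ≥0∞ :=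
  {z : Fin (N + 1) → ℝ | StrictMono z}.indicator
    (fun z => ((N + 1 + m).descFactorial (N + 1) : ℝ≥0∞) * P (Ioi (z (Fin.last N))) ^ m) z

theorem measurable_measure_Ioi (P : Measure ℝ) : Measurable fun t : ℝ => P (Ioi t) :=
  Antitone.measurable fun _ _ h => measure_mono (Ioi_subset_Ioi h)

theorem measurable_lowestDensity (P : Measure ℝ) (N m : ℕ) : Measurable (lowestDensity P N m) := by
  refine Measurable.indicator ?_ (measurableSet_strictMono _)
  exact (((measurable_measure_Ioi P).comp (measurable_pi_apply _)).pow_const m).const_mul _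

variable (P : Measure ℝ) [IsProbabilityMeasure P]

theorem measurePreserving_comp_perm {n : ℕ} (σ : Equiv.Perm (Fin n)) :
    MeasurePreserving (fun x : Fin n → ℝ => x ∘ σ) (Measure.pi fun _ => P)
      (Measure.pi fun _ => P) := by
  have hm : Measurable fun x : Fin n → ℝ => x ∘ σ :=
    measurable_pi_lambda _ fun i => measurable_pi_apply (σ i)
  refine ⟨hm, (Measure.pi_eq fun s hs => ?_).symm⟩
  rw [Measure.map_apply hm (MeasurableSet.univ_pi hs)]
  have : (fun x : Fin n → ℝ => x ∘ σ) ⁻¹' univ.pi s = univ.pi fun i => s (σ.symm i) := by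
    ext x
    simp only [mem_preimage, mem_univ_pi, Function.comp_apply]
    exact ⟨fun h i => by simpa using h (σ.symm i), fun h i => by simpa using h (σ i)⟩
  rw [this, Measure.pi_pi]
  exact Equiv.prod_comp σ.symm fun i => P (s i)

theorem measurePreserving_append (R m : ℕ) :
    MeasurePreserving (fun z : (Fin R → ℝ) × (Fin m → ℝ) => Fin.append z.1 z.2)
      ((Measure.pi fun _ => P).prod (Measure.pi fun _ => P)) (Measure.pi fun _ => P) := by
  have hm := measurable_append (measurable_fst (α := Fin R → ℝ) (β := Fin m → ℝ)) measurable_snd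
  refine ⟨hm, (Measure.pi_eq fun s hs => ?_).symm⟩
  rw [Measure.map_apply hm (MeasurableSet.univ_pi hs)]
  have : (fun z : (Fin R → ℝ) × (Fin m → ℝ) => Fin.append z.1 z.2) ⁻¹' univ.pi s =
      (univ.pi fun i => s (Fin.castAdd m i)) ×ˢ (univ.pi fun i => s (Fin.natAdd R i)) := by
    ext z
    simp only [mem_preimage, mem_univ_pi, mem_prod]
    constructor
    · exact fun h => ⟨fun i => by simpa using h (Fin.castAdd m i),
        fun i => by simpa using h (Fin.natAdd R i)⟩
    · rintro ⟨h1, h2⟩ i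
      refine Fin.addCases (fun i => ?_) (fun i => ?_) i
      · simpa using h1 i
      · simpa using h2 i
  rw [this, Measure.prod_prod, Measure.pi_pi, Measure.pi_pi, Fin.prod_univ_add]

/-- Each of the `n!` orderings of an i.i.d. sample is equally likely. -/
theorem measure_of_perm_invariant [NullSingletonClass P] {n : ℕ} {S : Set (Fin n → ℝ)}
    (hS : MeasurableSet S) (hinv : ∀ (σ : Equiv.Perm (Fin n)) x, x ∘ σ ∈ S ↔ x ∈ S) :
    (Measure.pi fun _ => P) S = n.factorial * (Measure.pi fun _ => P) (S ∩ {x | StrictMono x}) := by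
  set M := Measure.pi fun _ : Fin n => P
  set A : Equiv.Perm (Fin n) → Set (Fin n → ℝ) := fun σ =>
    (fun x : Fin n → ℝ => x ∘ σ) ⁻¹' (S ∩ {x | StrictMono x})
  have hSm : MeasurableSet (S ∩ {x | StrictMono x}) := hS.inter (measurableSet_strictMono n)
  have hA : ∀ σ, M (A σ) = M (S ∩ {x | StrictMono x}) := fun σ =>
    (measurePreserving_comp_perm P σ).measure_preimage hSm.nullMeasurableSet
  have hAm : ∀ σ, MeasurableSet (A σ) := fun σ =>
    (measurePreserving_comp_perm P σ).measurable hSm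
  have hdisj : Pairwise (Function.onFun Disjoint A) := by
    intro σ τ hne
    refine Set.disjoint_left.2 fun x h1 h2 => hne ?_
    have hx : Function.Injective x := by
      have := h1.2.injective
      intro i j hij
      have := @this (σ.symm i) (σ.symm j) (by simpa using hij)
      exact σ.symm.injective this
    have key : ∀ ρ : Equiv.Perm (Fin n), StrictMono (x ∘ ρ) → ρ = Tuple.sort x := fun ρ h =>
      Tuple.eq_sort_iff.2 ⟨h.monotone, fun i j hij he => absurd (h.injective he) hij.ne⟩
    rw [key σ h1.2, key τ h2.2]
  have hcov : S =ᵐ[M] ⋃ σ, A σ := by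
    filter_upwards [ae_pi_injective P n] with x hx
    refine propext ⟨fun h => ?_, fun h => ?_⟩
    · exact mem_iUnion.2 ⟨Tuple.sort x, (hinv _ x).2 h, strictMono_sort hx⟩
    · obtain ⟨σ, h1, -⟩ := mem_iUnion.1 h
      exact (hinv σ x).1 h1
  rw [measure_congr hcov, measure_iUnion hdisj hAm, tsum_fintype]
  simp_rw [hA]
  simp [Fintype.card_perm]

theorem factorial_mul_measure_strictMono_Ioi [NullSingletonClass P] (m : ℕ) (t : ℝ) :
    m.factorial * (Measure.pi fun _ : Fin m => P) {y | StrictMono y ∧ ∀ j, t < y j} =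
      P (Ioi t) ^ m := by
  have h := measure_of_perm_invariant P (n := m) (S := univ.pi fun _ => Ioi t)
    (MeasurableSet.univ_pi fun _ => measurableSet_Ioi) (fun σ x => by
      simp only [mem_univ_pi, Function.comp_apply]
      exact ⟨fun h i => by simpa using h (σ.symm i), fun h i => h (σ i)⟩)
  rw [Measure.pi_pi, Finset.prod_const, Finset.card_univ, Fintype.card_fin] at h
  rw [h]
  congr 2
  ext y
  simp [and_comm]

theorem strictMono_append_iff {N m : ℕ} (z : Fin (N + 1) → ℝ) (y : Fin m → ℝ) :
    StrictMono (Fin.append z y) ↔ StrictMono z ∧ StrictMono y ∧ ∀ j, z (Fin.last N) < y j := by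
  constructor
  · intro h
    refine ⟨fun i j hij => ?_, fun i j hij => ?_, fun j => ?_⟩
    · simpa using h ((Fin.strictMono_castAdd m) hij)
    · simpa using h ((Fin.strictMono_natAdd (N + 1)) hij)
    · have : Fin.castAdd m (Fin.last N) < Fin.natAdd (N + 1) j := by
        rw [Fin.lt_def]; simp; omega
      simpa using h this
  · rintro ⟨h1, h2, h3⟩ i
    refine Fin.addCases (fun i j => ?_) (fun i j => ?_) i
    · refine Fin.addCases (fun j hij => ?_) (fun j hij => ?_) j
      · simpa using h1 ((Fin.strictMono_castAdd m).lt_iff_lt.1 hij)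
      · simpa using (h1.monotone (Fin.le_last i)).trans_lt (h3 j)
    · refine Fin.addCases (fun j hij => ?_) (fun j hij => ?_) j
      · rw [Fin.lt_def] at hij
        simp at hij
        omega
      · simpa using h2 ((Fin.strictMono_natAdd (N + 1)).lt_iff_lt.1 hij)

theorem measurable_lowest (R m : ℕ) : Measurable (lowest : (Fin (R + m) → ℝ) → Fin R → ℝ) := by
  refine measurable_pi_lambda _ fun i => ?_
  have : (fun x : Fin (R + m) → ℝ => lowest x i) = fun x =>
      ∑ σ : Equiv.Perm (Fin (R + m)), if Tuple.sort x = σ then x (σ (Fin.castAdd m i)) else 0 := by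
    ext x
    rw [Finset.sum_eq_single (Tuple.sort x)]
    · simp [lowest]
    · intro σ _ h
      simp [h.symm]
    · simp
  rw [this]
  exact Finset.measurable_sum _ fun σ _ =>
    Measurable.ite (measurableSet_sort_eq σ) (by fun_prop) measurable_const

theorem lowest_comp_perm {R m : ℕ} (x : Fin (R + m) → ℝ) (σ : Equiv.Perm (Fin (R + m))) :
    lowest (x ∘ σ) = lowest x := by
  have := Tuple.comp_perm_comp_sort_eq_comp_sort (f := x) (σ := σ)
  ext i
  exact congr_fun this (Fin.castAdd m i)

/-- The law of the lowest types. By symmetry the sample may be taken to be ordered, and then its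
first `N + 1` entries are the lowest ones and the others contribute the factor `P (Ioi (z N)) ^ m /
m!`. -/
theorem map_lowest_pi [NullSingletonClass P] (N m : ℕ) :
    (Measure.pi fun _ : Fin (N + 1 + m) => P).map lowest =
      (Measure.pi fun _ : Fin (N + 1) => P).withDensity (lowestDensity P N m) := by
  ext B hB
  have hBS : MeasurableSet (B ∩ {z | StrictMono z}) := hB.inter (measurableSet_strictMono _)
  rw [Measure.map_apply (measurable_lowest _ _) hB, withDensity_apply _ hB,
    measure_of_perm_invariant P (measurable_lowest _ _ hB)
      (fun σ x => by simp [mem_preimage, lowest_comp_perm])]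
  unfold lowestDensity
  rw [setLIntegral_indicator (measurableSet_strictMono _), inter_comm,
    lintegral_const_mul' _ _ (ENNReal.natCast_ne_top _)]
  have h1 : (Measure.pi fun _ : Fin (N + 1 + m) => P) ({x | StrictMono x} ∩ lowest ⁻¹' B) =
      ∫⁻ z in {z | StrictMono z} ∩ B, (Measure.pi fun _ : Fin m => P)
        {y | StrictMono y ∧ ∀ j, z (Fin.last N) < y j} ∂(Measure.pi fun _ : Fin (N + 1) => P) := by
    have hm : MeasurableSet ({x : Fin (N + 1 + m) → ℝ | StrictMono x} ∩ lowest ⁻¹' B) :=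
      (measurableSet_strictMono _).inter (measurable_lowest _ _ hB)
    rw [← (measurePreserving_append P (N + 1) m).measure_preimage hm.nullMeasurableSet,
      Measure.prod_apply ((measurePreserving_append P (N + 1) m).measurable hm),
      ← lintegral_indicator ((measurableSet_strictMono _).inter hB)]
    refine lintegral_congr fun z => ?_
    by_cases hz : z ∈ {z : Fin (N + 1) → ℝ | StrictMono z} ∩ B
    · rw [indicator_of_mem hz]
      congr 1
      ext y
      simp only [mem_preimage, mem_inter_iff, mem_ofPred_eq, strictMono_append_iff]
      constructor
      · exact fun h => h.1.2
      · intro h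
        have hmono : StrictMono (Fin.append z y) := (strictMono_append_iff z y).2 ⟨hz.1, h⟩
        refine ⟨⟨hz.1, h⟩, ?_⟩
        have : lowest (Fin.append z y) = z := by
          ext i
          simp [lowest, sort_eq_refl hmono.monotone]
        rw [this]
        exact hz.2
    · rw [indicator_of_notMem hz]
      convert measure_empty (μ := Measure.pi fun _ : Fin m => P)
      ext y
      simp only [mem_preimage, mem_inter_iff, mem_ofPred_eq, mem_empty_iff_false, iff_false]
      rintro ⟨h1, h2⟩
      apply hz
      refine ⟨((strictMono_append_iff z y).1 h1).1, ?_⟩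
      have : lowest (Fin.append z y) = z := by
        ext i
        simp [lowest, sort_eq_refl h1.monotone]
      rwa [this] at h2
  have h2 : ((N + 1 + m).factorial : ℝ≥0∞) =
      ((N + 1 + m).descFactorial (N + 1) : ℝ≥0∞) * (m.factorial : ℝ≥0∞) := by
    have := Nat.factorial_mul_descFactorial (show N + 1 ≤ N + 1 + m by omega)
    rw [Nat.add_sub_cancel_left] at this
    rw [← this]
    push_cast
    ring
  rw [h1, h2, mul_assoc, ← lintegral_const_mul']
  · simp_rw [factorial_mul_measure_strictMono_Ioi]
  · exact ENNReal.natCast_ne_top _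

end OrderStatistics

section Density

theorem lintegral_fin_prod_eq_prod {n : ℕ} (μ : Fin n → Measure ℝ) [∀ i, SigmaFinite (μ i)]
    {h : Fin n → ℝ → ℝ≥0∞} (hh : ∀ i, Measurable (h i)) :
    ∫⁻ x : Fin n → ℝ, ∏ i, h i (x i) ∂(Measure.pi μ) = ∏ i, ∫⁻ t, h i t ∂(μ i) := by
  induction n with
  | zero => simp
  | succ n ih =>
    have hm : Measurable fun x : Fin (n + 1) → ℝ => ∏ i, h i (x i) := by fun_prop
    rw [← ((measurePreserving_piFinSuccAbove μ 0).symm).lintegral_comp hm]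
    simp_rw [MeasurableEquiv.piFinSuccAbove_symm_apply, Fin.insertNthEquiv,
      Fin.prod_univ_succ, Fin.insertNth_zero, Equiv.coe_fn_mk, Fin.cons_succ, Fin.zero_succAbove,
      Fin.cons_zero, cast_eq]
    have hm' : Measurable fun x : Fin n → ℝ => ∏ i, h i.succ (x i) :=
      Finset.measurable_prod _ fun i _ => (hh i.succ).comp (measurable_pi_apply i)
    rw [lintegral_prod_mul (f := h 0) (g := fun x : Fin n → ℝ => ∏ i, h i.succ (x i))
      (hh 0).aemeasurable hm'.aemeasurable, ih _ fun i => hh _]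

theorem pi_withDensity {n : ℕ} {h : ℝ → ℝ≥0∞} (hh : Measurable h)
    [SigmaFinite (volume.withDensity h)] :
    (Measure.pi fun _ : Fin n => volume.withDensity h) =
      volume.withDensity fun x : Fin n → ℝ => ∏ i, h (x i) := by
  refine Measure.pi_eq fun s hs => ?_
  rw [withDensity_apply _ (MeasurableSet.univ_pi hs), volume_pi, Measure.restrict_pi_pi,
    lintegral_fin_prod_eq_prod _ fun _ => hh]
  exact Finset.prod_congr rfl fun i _ => (withDensity_apply _ (hs i)).symm

theorem map_withDensity_comp {α β : Type*} [MeasurableSpace α] [MeasurableSpace β] {μ : Measure α}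
    {g : α → β} (hg : Measurable g) {d : β → ℝ≥0∞} (hd : Measurable d) :
    (μ.withDensity (d ∘ g)).map g = (μ.map g).withDensity d := by
  ext s hs
  rw [Measure.map_apply hg hs, withDensity_apply _ (hg hs), withDensity_apply _ hs,
    setLIntegral_map hs hd hg]
  rfl

/-- The points to the right of `a` with successive gaps `δ E₀, δ E₁, …`, the first one at distance
`δ E₀` from `a`. -/
def pointsOfGaps {R : ℕ} (a δ : ℝ) (E : Fin R → ℝ) : Fin R → ℝ :=
  fun i => a + δ * ∑ j ∈ Finset.Iic i, E j

theorem measurable_pointsOfGaps {R : ℕ} (a δ : ℝ) :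
    Measurable (pointsOfGaps a δ : (Fin R → ℝ) → Fin R → ℝ) := by
  unfold pointsOfGaps; fun_prop

/-- The Jacobian of the passage from gaps to points is triangular. -/
theorem map_pointsOfGaps_volume {R : ℕ} (a : ℝ) {δ : ℝ} (hδ : 0 < δ) :
    (volume : Measure (Fin R → ℝ)).map (pointsOfGaps a δ) =
      ENNReal.ofReal (δ ^ R)⁻¹ • volume := by
  set M : Matrix (Fin R) (Fin R) ℝ := Matrix.of fun i j => if j ≤ i then δ else 0
  have hdet : M.det = δ ^ R := by
    rw [Matrix.det_of_isLowerTriangular]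
    · simp [M]
    · intro i j hij
      have : ¬ j ≤ i := not_le.2 (by simpa using hij)
      simp [M, this]
  have hfun : (pointsOfGaps a δ : (Fin R → ℝ) → Fin R → ℝ) =
      (fun z => (fun _ => a) + z) ∘ Matrix.toLin' M := by
    ext E i
    simp only [pointsOfGaps, Function.comp_apply, Pi.add_apply, Matrix.toLin'_apply,
      Matrix.mulVec, dotProduct, M, Matrix.of_apply, ite_mul, zero_mul]
    rw [Finset.mul_sum, ← Finset.sum_filter]
    congr 1
    refine Finset.sum_congr ?_ fun _ _ => rfl
    ext j
    simp
  have hm : Measurable (Matrix.toLin' M) := by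
    apply Continuous.measurable
    exact LinearMap.continuous_on_pi _
  rw [hfun, ← Measure.map_map (by fun_prop) hm,
    Real.map_matrix_volume_pi_eq_smul_volume_pi (by rw [hdet]; positivity), hdet,
    Measure.map_smul, (measurePreserving_add_left volume (fun _ : Fin R => a)).map_eq,
    abs_of_nonneg (by positivity)]

theorem sum_Iic_pos {R : ℕ} {E : Fin R → ℝ} (hE : ∀ i, 0 < E i) (i : Fin R) :
    0 < ∑ j ∈ Finset.Iic i, E j :=
  Finset.sum_pos (fun j _ => hE j) ⟨i, by simp⟩

theorem strictMono_sum_Iic {R : ℕ} {E : Fin R → ℝ} (hE : ∀ i, 0 < E i) :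
    StrictMono fun i => ∑ j ∈ Finset.Iic i, E j := by
  intro i j hij
  refine Finset.sum_lt_sum_of_subset (i := j) (Finset.Iic_subset_Iic.2 hij.le) (by simp) ?_ (hE j)
    fun l _ _ => (hE l).le
  simpa using hij

theorem strictMono_pointsOfGaps {R : ℕ} (a : ℝ) {δ : ℝ} (hδ : 0 < δ) {E : Fin R → ℝ}
    (hE : ∀ i, 0 < E i) : StrictMono (pointsOfGaps a δ E) := by
  intro i j hij
  have := mul_lt_mul_of_pos_left (strictMono_sum_Iic hE hij) hδ
  simpa [pointsOfGaps] using this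

/-- The density of the law of the gaps, scaled by `δ`, between the `N + 1` lowest of `N + 1 + m`
types that are i.i.d. from the density `h`. -/
noncomputable def gapDensity (h : ℝ → ℝ≥0∞) (a δ : ℝ) (N m : ℕ) (E : Fin (N + 1) → ℝ) : ℝ≥0∞ :=
  ENNReal.ofReal (δ ^ (N + 1)) * ((∏ i, h (pointsOfGaps a δ E i)) *
    lowestDensity (volume.withDensity h) N m (pointsOfGaps a δ E))

theorem measurable_gapDensity {h : ℝ → ℝ≥0∞} (hh : Measurable h)
    [IsProbabilityMeasure (volume.withDensity h)] (a δ : ℝ) (N m : ℕ) :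
    Measurable (gapDensity h a δ N m) := by
  have h1 := measurable_pointsOfGaps (R := N + 1) a δ
  have h2 := (measurable_lowestDensity (volume.withDensity h) N m).comp h1
  have h3 : Measurable fun E : Fin (N + 1) → ℝ => ∏ i, h (pointsOfGaps a δ E i) := by fun_prop
  exact (h3.mul h2).const_mul _

theorem map_pointsOfGaps_gapDensity {h : ℝ → ℝ≥0∞} (hh : Measurable h)
    [IsProbabilityMeasure (volume.withDensity h)] (a : ℝ) {δ : ℝ} (hδ : 0 < δ) (N m : ℕ) :
    (volume.withDensity (gapDensity h a δ N m)).map (pointsOfGaps a δ) =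
      (Measure.pi fun _ : Fin (N + 1 + m) => volume.withDensity h).map lowest := by
  set P := volume.withDensity h
  set d : (Fin (N + 1) → ℝ) → ℝ≥0∞ := fun z => (∏ i, h (z i)) * lowestDensity P N m z
  have hl := measurable_lowestDensity P N m
  have hd : Measurable d := by fun_prop
  have e1 : gapDensity h a δ N m =
      ENNReal.ofReal (δ ^ (N + 1)) • (d ∘ pointsOfGaps a δ) := rfl
  rw [map_lowest_pi, pi_withDensity hh, ← withDensity_mul _ (by fun_prop) hl, e1,
    withDensity_smul _ (hd.comp (measurable_pointsOfGaps a δ)), Measure.map_smul,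
    map_withDensity_comp (measurable_pointsOfGaps a δ) hd, map_pointsOfGaps_volume a hδ,
    withDensity_smul_measure, smul_smul, ← ENNReal.ofReal_mul (by positivity),
    mul_inv_cancel₀ (by positivity), ENNReal.ofReal_one, one_smul]
  rfl

end Density

/-! ### Convergence of densities -/

section DensityConvergence

variable {α : Type*} [MeasurableSpace α] {lam : Measure α} {p : ℕ → α → ℝ≥0∞} {q : α → ℝ≥0∞}

/-- The half of Scheffé's lemma that is Fatou's lemma; the other half follows by passing to
complements. -/
theorem eventually_lt_measure_withDensity (hpm : ∀ n, Measurable (p n)) (hqm : Measurable q)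
    (hp : ∀ᵐ x ∂(lam.withDensity q), Tendsto (fun n => p n x) atTop (𝓝 (q x)))
    {A : ℕ → Set α} {B : Set α} (hA : ∀ n, MeasurableSet (A n)) (hB : MeasurableSet B)
    (hAB : ∀ᵐ x ∂(lam.withDensity q), ∀ᶠ n in atTop, (x ∈ A n ↔ x ∈ B)) {c : ℝ≥0∞}
    (hc : c < lam.withDensity q B) : ∀ᶠ n in atTop, c < lam.withDensity (p n) (A n) := by
  have h1 : lam.withDensity q B ≤ liminf (fun n => lam.withDensity (p n) (A n)) atTop := by
    rw [withDensity_apply _ hB, ← lintegral_indicator hB]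
    have h2 : ∀ n, lam.withDensity (p n) (A n) = ∫⁻ x, (A n).indicator (p n) x ∂lam := fun n => by
      rw [withDensity_apply _ (hA n), lintegral_indicator (hA n)]
    simp_rw [h2]
    refine le_trans (lintegral_mono_ae ?_)
      (lintegral_liminf_le fun n => (hpm n).indicator (hA n))
    rw [ae_withDensity_iff hqm] at hp hAB
    filter_upwards [hp, hAB] with x h3 h4
    by_cases hx : x ∈ B
    · rw [indicator_of_mem hx]
      by_cases h0 : q x = 0
      · rw [h0]; exact zero_le
      · refine le_of_eq ((h3 h0).congr' ?_).liminf_eq.symm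
        filter_upwards [h4 h0] with n hn
        rw [indicator_of_mem (hn.2 hx)]
    · rw [indicator_of_notMem hx]
      exact zero_le
  exact eventually_lt_of_lt_liminf (hc.trans_le h1)

/-- A form of Scheffé's lemma: if probability densities converge pointwise to a probability
density and the events `A n` converge pointwise to `B`, the probabilities converge. Only almost
every point for the limit law matters, and no domination is needed. -/
theorem tendsto_measureReal_withDensity [∀ n, IsProbabilityMeasure (lam.withDensity (p n))]
    [IsProbabilityMeasure (lam.withDensity q)]
    (hpm : ∀ n, Measurable (p n)) (hqm : Measurable q)
    (hp : ∀ᵐ x ∂(lam.withDensity q), Tendsto (fun n => p n x) atTop (𝓝 (q x)))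
    {A : ℕ → Set α} {B : Set α} (hA : ∀ n, MeasurableSet (A n)) (hB : MeasurableSet B)
    (hAB : ∀ᵐ x ∂(lam.withDensity q), ∀ᶠ n in atTop, (x ∈ A n ↔ x ∈ B)) :
    Tendsto (fun n => (lam.withDensity (p n)).real (A n)) atTop
      (𝓝 ((lam.withDensity q).real B)) := by
  have low : ∀ {A : ℕ → Set α} {B : Set α} (_ : ∀ n, MeasurableSet (A n)) (_ : MeasurableSet B)
      (_ : ∀ᵐ x ∂(lam.withDensity q), ∀ᶠ n in atTop, (x ∈ A n ↔ x ∈ B)) {c : ℝ},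
      c < (lam.withDensity q).real B → ∀ᶠ n in atTop, c < (lam.withDensity (p n)).real (A n) := by
    intro A B hA hB hAB c hc
    rcases lt_or_ge c 0 with h0 | h0
    · exact Eventually.of_forall fun n => h0.trans_le measureReal_nonneg
    · have h1 := eventually_lt_measure_withDensity hpm hqm hp hA hB hAB
        ((ENNReal.ofReal_lt_iff_lt_toReal h0 (measure_ne_top _ _)).2 hc)
      filter_upwards [h1] with n hn
      exact (ENNReal.ofReal_lt_iff_lt_toReal h0 (measure_ne_top _ _)).1 hn
  refine tendsto_order.2 ⟨fun c hc => low hA hB hAB hc, fun c hc => ?_⟩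
  have h1 : 1 - c < (lam.withDensity q).real Bᶜ := by
    rw [probReal_compl_eq_one_sub hB]; linarith
  have h2 := low (fun n => (hA n).compl) hB.compl (by
    filter_upwards [hAB] with x hx
    filter_upwards [hx] with n hn
    exact not_congr hn) h1
  filter_upwards [h2] with n hn
  rw [probReal_compl_eq_one_sub (hA n)] at hn
  linarith

/-- The version of `tendsto_measureReal_withDensity` for two independent samples. -/
theorem tendsto_measureReal_prod_withDensity {β : Type*} [MeasurableSpace β] {mu : Measure α}
    {nu : Measure β} [SFinite mu] [SFinite nu] {d : ℕ → α → ℝ≥0∞} {d' : ℕ → β → ℝ≥0∞}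
    {e : α → ℝ≥0∞} {e' : β → ℝ≥0∞}
    [∀ n, IsProbabilityMeasure (mu.withDensity (d n))]
    [∀ n, IsProbabilityMeasure (nu.withDensity (d' n))]
    [IsProbabilityMeasure (mu.withDensity e)] [IsProbabilityMeasure (nu.withDensity e')]
    (hd : ∀ n, Measurable (d n)) (hd' : ∀ n, Measurable (d' n)) (he : Measurable e)
    (he' : Measurable e') (het : ∀ x, e x ≠ ∞) (het' : ∀ x, e' x ≠ ∞)
    (hlim : ∀ᵐ x ∂(mu.withDensity e), Tendsto (fun n => d n x) atTop (𝓝 (e x)))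
    (hlim' : ∀ᵐ x ∂(nu.withDensity e'), Tendsto (fun n => d' n x) atTop (𝓝 (e' x)))
    {A : ℕ → Set (α × β)} {B : Set (α × β)} (hA : ∀ n, MeasurableSet (A n)) (hB : MeasurableSet B)
    (hAB : ∀ᵐ z ∂((mu.withDensity e).prod (nu.withDensity e')),
      ∀ᶠ n in atTop, (z ∈ A n ↔ z ∈ B)) :
    Tendsto (fun n => ((mu.withDensity (d n)).prod (nu.withDensity (d' n))).real (A n)) atTop
      (𝓝 (((mu.withDensity e).prod (nu.withDensity e')).real B)) := by
  have hprod : ∀ n, (mu.withDensity (d n)).prod (nu.withDensity (d' n)) =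
      (mu.prod nu).withDensity fun z => d n z.1 * d' n z.2 :=
    fun n => prod_withDensity (hd n) (hd' n)
  have hprod' : (mu.withDensity e).prod (nu.withDensity e') =
      (mu.prod nu).withDensity fun z => e z.1 * e' z.2 := prod_withDensity he he'
  have h1 : ∀ n, IsProbabilityMeasure ((mu.prod nu).withDensity fun z => d n z.1 * d' n z.2) :=
    fun n => by rw [← hprod]; infer_instance
  have h2 : IsProbabilityMeasure ((mu.prod nu).withDensity fun z => e z.1 * e' z.2) := by
    rw [← hprod']; infer_instance
  have h3 : ∀ᵐ z ∂((mu.withDensity e).prod (nu.withDensity e')),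
      Tendsto (fun n => d n z.1 * d' n z.2) atTop (𝓝 (e z.1 * e' z.2)) := by
    filter_upwards [Measure.quasiMeasurePreserving_fst.ae hlim,
      Measure.quasiMeasurePreserving_snd.ae hlim'] with z hz hz'
    exact ENNReal.Tendsto.mul hz (Or.inr (het' _)) hz' (Or.inr (het _))
  simp_rw [hprod]
  rw [hprod'] at hAB h3 ⊢
  exact tendsto_measureReal_withDensity (fun n => by fun_prop) (by fun_prop) h3 hA hB hAB

end DensityConvergence

section TypeLaw

/-- The density of `typeLaw f a b` on the whole line. -/
noncomputable def typeDensity (f : ℝ → ℝ) (a b : ℝ) : ℝ → ℝ≥0∞ :=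
  (Icc a b).indicator fun x => ENNReal.ofReal (f x)

theorem typeLaw_eq_withDensity (f : ℝ → ℝ) (a b : ℝ) :
    typeLaw f a b = volume.withDensity (typeDensity f a b) :=
  (withDensity_indicator measurableSet_Icc _).symm

variable {f : ℝ → ℝ} {a b : ℝ}

theorem IsDensityOn.measurable_typeDensity (hf : IsDensityOn f a b) :
    Measurable (typeDensity f a b) :=
  hf.measurable.ennreal_ofReal.indicator measurableSet_Icc

theorem IsDensityOn.isProbabilityMeasure (hf : IsDensityOn f a b) :
    IsProbabilityMeasure (typeLaw f a b) := by
  refine ⟨?_⟩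
  rw [typeLaw, withDensity_apply _ MeasurableSet.univ, Measure.restrict_univ,
    hf.lintegral_eq_one]

instance nullSingletonClass_typeLaw : NullSingletonClass (typeLaw f a b) := by
  unfold typeLaw
  infer_instance

theorem IsDensityOn.lt (hf : IsDensityOn f a b) : a < b := by
  by_contra h
  have h1 := hf.lintegral_eq_one
  have : volume (Icc a b) = 0 := by
    rw [Real.volume_Icc, ENNReal.ofReal_eq_zero]; linarith
  rw [setLIntegral_measure_zero _ _ this] at h1
  exact zero_ne_one h1

theorem ae_typeLaw_mem_Icc : ∀ᵐ x ∂(typeLaw f a b), x ∈ Icc a b :=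
  (withDensity_absolutelyContinuous _ _).ae_le (ae_restrict_mem measurableSet_Icc)

theorem IsDensityOn.setIntegral_Iio (hf : IsDensityOn f a b) {x : ℝ} (hx : x ∈ Icc a b)
    (G : ℝ → ℝ) : ∫ v in Iio x, G v ∂(typeLaw f a b) = ∫ v in a..x, f v * G v := by
  rw [typeLaw, setIntegral_withDensity_eq_setIntegral_toReal_smul hf.measurable.ennreal_ofReal
    (ae_of_all _ fun _ => ENNReal.ofReal_lt_top) _ measurableSet_Iio,
    Measure.restrict_restrict measurableSet_Iio, intervalIntegral.integral_of_le hx.1]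
  have h1 : (Iio x ∩ Icc a b : Set ℝ) = Ico a x := by
    ext v
    simp only [mem_inter_iff, mem_Iio, mem_Icc, mem_Ico]
    constructor
    · rintro ⟨h1, h2, h3⟩; exact ⟨h2, h1⟩
    · rintro ⟨h1, h2⟩; exact ⟨h2, h1, h2.le.trans hx.2⟩
  rw [h1, setIntegral_congr_set Ico_ae_eq_Ioc]
  refine setIntegral_congr_fun measurableSet_Ioc fun v hv => ?_
  simp only [smul_eq_mul]
  rw [ENNReal.toReal_ofReal (hf.nonneg v ⟨hv.1.le, hv.2.trans hx.2⟩)]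

theorem IsDensityOn.tendsto_apply_add_mul (hf : IsDensityOn f a b)
    {δ : ℕ → ℝ} (hδ0 : ∀ n, 0 < δ n)
    (hδ : Tendsto δ atTop (𝓝 0)) {s : ℝ} (hs : 0 ≤ s) :
    Tendsto (fun n => a + δ n * s) atTop (𝓝[Icc a b] a) := by
  have h1 : Tendsto (fun n => a + δ n * s) atTop (𝓝 a) := by
    simpa using (hδ.mul_const s).const_add a
  refine tendsto_nhdsWithin_iff.2 ⟨h1, ?_⟩
  filter_upwards [h1.eventually (gt_mem_nhds hf.lt)] with n hn
  exact ⟨le_add_of_nonneg_right (mul_nonneg (hδ0 n).le hs), hn.le⟩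

/-- Near the endpoint `a`, at the scale `δ`, the law looks like Lebesgue measure with constant
density `f a`. -/
theorem IsDensityOn.tendsto_scaled_setIntegral (hf : IsDensityOn f a b)
    (hc : ContinuousWithinAt f (Icc a b) a) {δ : ℕ → ℝ} (hδ0 : ∀ n, 0 < δ n)
    (hδ : Tendsto δ atTop (𝓝 0)) {ψ : ℝ → ℝ} (hψ : Continuous ψ) {V : ℝ} (hV : 0 ≤ V) :
    Tendsto (fun n => (δ n)⁻¹ * ∫ v in Iio (a + δ n * V), ψ ((v - a) / δ n) ∂(typeLaw f a b))
      atTop (𝓝 (f a * ∫ s in (0:ℝ)..V, ψ s)) := by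
  have hend := hf.tendsto_apply_add_mul hδ0 hδ hV
  have h1 : ∀ᶠ n in atTop, ∫ s in (0:ℝ)..V, f (a + δ n * s) * ψ s =
      (δ n)⁻¹ * ∫ v in Iio (a + δ n * V), ψ ((v - a) / δ n) ∂(typeLaw f a b) := by
    filter_upwards [(tendsto_nhdsWithin_iff.1 hend).2] with n hn
    rw [hf.setIntegral_Iio hn]
    have h2 := intervalIntegral.integral_comp_add_mul (a := 0) (b := V)
      (fun v => f v * ψ ((v - a) / δ n)) (hδ0 n).ne' a
    simp only [mul_zero, add_zero, add_sub_cancel_left, smul_eq_mul] at h2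
    rw [← h2]
    refine intervalIntegral.integral_congr fun s _ => ?_
    rw [mul_div_cancel_left₀ _ (hδ0 n).ne']
  rw [← intervalIntegral.integral_const_mul]
  refine Tendsto.congr' h1 ?_
  -- uniformly in `s ∈ [0, V]`, eventually `|f (a + δ n * s)| ≤ |f a| + 1`
  have hbd : ∀ᶠ n in atTop, ∀ s ∈ uIoc (0:ℝ) V, |f (a + δ n * s)| ≤ |f a| + 1 := by
    have h3 : ∀ᶠ x in 𝓝[Icc a b] a, |f x| < |f a| + 1 :=
      hc.abs.eventually (gt_mem_nhds (lt_add_one _))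
    rw [eventually_nhdsWithin_iff, Metric.eventually_nhds_iff] at h3
    obtain ⟨ε, hε, h3⟩ := h3
    have h4 := (hend.mono_right nhdsWithin_le_nhds).eventually (Metric.ball_mem_nhds a hε)
    filter_upwards [h4, (tendsto_nhdsWithin_iff.1 hend).2] with n h4 h5 s hs
    rw [uIoc_of_le hV] at hs
    have h6 : δ n * s ≤ δ n * V := mul_le_mul_of_nonneg_left hs.2 (hδ0 n).le
    have h7 : 0 ≤ δ n * s := mul_nonneg (hδ0 n).le hs.1.le
    refine (h3 ?_ ⟨by linarith, by linarith [h5.2]⟩).le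
    rw [dist_eq_norm, Real.norm_eq_abs, abs_lt] at h4
    rw [dist_eq_norm, Real.norm_eq_abs, abs_lt]
    constructor <;> linarith
  refine intervalIntegral.tendsto_integral_filter_of_dominated_convergence
    (fun s => (|f a| + 1) * |ψ s|) ?_ ?_ ?_ ?_
  · refine Eventually.of_forall fun n => ?_
    exact (hf.measurable.comp (by fun_prop)).aestronglyMeasurable.mul hψ.aestronglyMeasurable
  · filter_upwards [hbd] with n hn
    refine ae_of_all _ fun s hs => ?_
    rw [Real.norm_eq_abs, abs_mul]
    exact mul_le_mul_of_nonneg_right (hn s hs) (abs_nonneg _)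
  · exact (Continuous.intervalIntegrable (by fun_prop) _ _)
  · refine ae_of_all _ fun s hs => ?_
    rw [uIoc_of_le hV] at hs
    exact (hc.tendsto.comp (hf.tendsto_apply_add_mul hδ0 hδ hs.1.le)).mul_const _

theorem IsDensityOn.tendsto_scaled_measureReal (hf : IsDensityOn f a b)
    (hc : ContinuousWithinAt f (Icc a b) a) {δ : ℕ → ℝ} (hδ0 : ∀ n, 0 < δ n)
    (hδ : Tendsto δ atTop (𝓝 0)) {V : ℝ} (hV : 0 ≤ V) :
    Tendsto (fun n => (δ n)⁻¹ * (typeLaw f a b).real (Iio (a + δ n * V)))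
      atTop (𝓝 (f a * V)) := by
  have := hf.tendsto_scaled_setIntegral hc hδ0 hδ (ψ := fun _ => 1) continuous_const hV
  simpa using this

/-- The scale `1 / (n c)` of the gaps between the lowest of `n = N + 1 + m` types, if the density at
the endpoint is `c`. -/
noncomputable def gapScale (c : ℝ) (N m : ℕ) : ℝ := (((N + 1 + m : ℕ) : ℝ) * c)⁻¹

theorem gapScale_pos {c : ℝ} (hc : 0 < c) (N m : ℕ) : 0 < gapScale c N m := by
  unfold gapScale; positivity

theorem tendsto_natCast_add_atTop (N : ℕ) :
    Tendsto (fun m : ℕ => ((N + 1 + m : ℕ) : ℝ)) atTop atTop :=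
  tendsto_natCast_atTop_atTop.comp (tendsto_atTop_mono (fun m => Nat.le_add_left m _) tendsto_id)

theorem tendsto_gapScale {c : ℝ} (hc : 0 < c) (N : ℕ) :
    Tendsto (gapScale c N) atTop (𝓝 0) :=
  ((tendsto_natCast_add_atTop N).atTop_mul_const hc).inv_tendsto_atTop

theorem tendsto_descFactorial_mul_gapScale (c : ℝ) (N : ℕ) :
    Tendsto (fun m => gapScale c N m ^ (N + 1) * ((N + 1 + m).descFactorial (N + 1) : ℝ)) atTop
      (𝓝 ((c ^ (N + 1))⁻¹)) := by
  have h1 := (Asymptotics.isEquivalent_iff_tendsto_one ?_).1 (isEquivalent_descFactorial (N + 1))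
  · have h2 : Tendsto (fun m : ℕ => N + 1 + m) atTop atTop :=
      tendsto_atTop_mono (fun m => Nat.le_add_left m _) tendsto_id
    have h3 := (h1.comp h2).const_mul ((c ^ (N + 1))⁻¹)
    rw [mul_one] at h3
    refine h3.congr fun m => ?_
    simp only [gapScale, Function.comp_apply, Pi.div_apply]
    rw [inv_pow, mul_pow, mul_inv]
    ring
  · filter_upwards [eventually_gt_atTop 0] with n hn
    positivity

/-- The probability that no further type is below the lowest ones; the choice of `gapScale` makes
the limit free of the density. -/
theorem IsDensityOn.tendsto_measureReal_Ioi_pow (hf : IsDensityOn f a b)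
    (hc : ContinuousWithinAt f (Icc a b) a) (ha : 0 < f a) (N : ℕ) {V : ℝ} (hV : 0 ≤ V) :
    Tendsto (fun m => (typeLaw f a b).real (Ioi (a + gapScale (f a) N m * V)) ^ m) atTop
      (𝓝 (Real.exp (-V))) := by
  have := hf.isProbabilityMeasure
  have h1 := hf.tendsto_scaled_measureReal hc (gapScale_pos ha N) (tendsto_gapScale ha N) hV
  have h2 : Tendsto
      (fun m : ℕ => (m : ℝ) * -(typeLaw f a b).real (Iio (a + gapScale (f a) N m * V))) atTop (𝓝 (-V)) := by
    have h3 : Tendsto (fun m : ℕ => (m : ℝ) / ((N + 1 + m : ℕ) : ℝ)) atTop (𝓝 1) := by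
      have := tendsto_natCast_div_add_atTop (𝕜 := ℝ) ((N:ℝ) + 1)
      refine this.congr fun m => ?_
      push_cast
      ring
    have h4 := ((h3.mul h1).const_mul (f a)⁻¹).neg
    refine (h4.congr fun m => ?_).trans (le_of_eq ?_)
    · rw [gapScale, inv_inv]
      have : (0:ℝ) < ((N + 1 + m : ℕ) : ℝ) := by positivity
      field_simp
    · congr 1
      field_simp
  refine (Real.tendsto_one_add_pow_exp_of_tendsto h2).congr fun m => ?_
  congr 1
  have h5 : Ioi (a + gapScale (f a) N m * V) = (Iic (a + gapScale (f a) N m * V))ᶜ := by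
    rw [compl_Iic]
  rw [h5, probReal_compl_eq_one_sub measurableSet_Iic, measureReal_congr Iio_ae_eq_Iic]
  ring

theorem lowestDensity_of_strictMono (P : Measure ℝ) [IsProbabilityMeasure P] (N m : ℕ)
    {z : Fin (N + 1) → ℝ} (hz : StrictMono z) : lowestDensity P N m z =
      ENNReal.ofReal ((N + 1 + m).descFactorial (N + 1) * P.real (Ioi (z (Fin.last N))) ^ m) := by
  rw [lowestDensity, indicator_of_mem (show z ∈ {z : Fin (N + 1) → ℝ | StrictMono z} from hz),
    ENNReal.ofReal_mul (by positivity),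
    ENNReal.ofReal_natCast, ENNReal.ofReal_pow measureReal_nonneg, ofReal_measureReal]

theorem Iic_last (N : ℕ) : Finset.Iic (Fin.last N) = Finset.univ := by
  ext i
  simp [Fin.le_last]

/-- The scaled gaps between the lowest types converge in law, in the sense of densities, to
independent exponential random variables. -/
theorem IsDensityOn.tendsto_gapDensity (hf : IsDensityOn f a b)
    (hc : ContinuousWithinAt f (Icc a b) a) (ha : 0 < f a) (N : ℕ) {E : Fin (N + 1) → ℝ}
    (hE : ∀ i, 0 < E i) :
    Tendsto (fun m => gapDensity (typeDensity f a b) a (gapScale (f a) N m) N m E) atTop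
      (𝓝 (∏ i, gammaPDF 1 1 (E i))) := by
  have hprob : IsProbabilityMeasure (volume.withDensity (typeDensity f a b)) := by
    rw [← typeLaw_eq_withDensity]; exact hf.isProbabilityMeasure
  set δ := gapScale (f a) N
  set U : Fin (N + 1) → ℝ := fun i => ∑ j ∈ Finset.Iic i, E j with hU
  have hmem : ∀ i, Tendsto (fun m => a + δ m * U i) atTop (𝓝[Icc a b] a) := fun i =>
    hf.tendsto_apply_add_mul (gapScale_pos ha N) (tendsto_gapScale ha N) (sum_Iic_pos hE i).le
  have hfin : ∀ᶠ m in atTop, gapDensity (typeDensity f a b) a (δ m) N m E =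
      ENNReal.ofReal ((δ m ^ (N + 1) * ((N + 1 + m).descFactorial (N + 1) : ℝ)) *
        (∏ i, f (a + δ m * U i)) *
          (typeLaw f a b).real (Ioi (a + δ m * U (Fin.last N))) ^ m) := by
    have h1 : ∀ᶠ m in atTop, ∀ i, a + δ m * U i ∈ Icc a b :=
      eventually_all.2 fun i => (tendsto_nhdsWithin_iff.1 (hmem i)).2
    filter_upwards [h1] with m hm
    have hδm : 0 < δ m := gapScale_pos ha N m
    have h2 : ∏ i, typeDensity f a b (pointsOfGaps a (δ m) E i) =
        ENNReal.ofReal (∏ i, f (a + δ m * U i)) := by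
      rw [ENNReal.ofReal_prod_of_nonneg fun i _ => hf.nonneg _ (hm i)]
      exact Finset.prod_congr rfl fun i _ => indicator_of_mem (hm i) _
    have h3 : 0 ≤ ∏ i, f (a + δ m * U i) := Finset.prod_nonneg fun i _ => hf.nonneg _ (hm i)
    rw [gapDensity, lowestDensity_of_strictMono _ _ _ (strictMono_pointsOfGaps a hδm hE), h2,
      ← ENNReal.ofReal_mul h3, ← ENNReal.ofReal_mul (by positivity), ← typeLaw_eq_withDensity]
    congr 1
    have : pointsOfGaps a (δ m) E (Fin.last N) = a + δ m * U (Fin.last N) := rfl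
    rw [this]
    ring
  refine Tendsto.congr' (hfin.mono fun _ h => h.symm) ?_
  have hlim : ∏ i, gammaPDF 1 1 (E i) =
      ENNReal.ofReal ((f a ^ (N + 1))⁻¹ * (∏ _i : Fin (N + 1), f a) *
        Real.exp (-U (Fin.last N))) := by
    rw [Finset.prod_const, Finset.card_univ, Fintype.card_fin, inv_mul_cancel₀ (by positivity),
      one_mul, hU]
    simp only [Iic_last]
    rw [← Finset.sum_neg_distrib, Real.exp_sum, ENNReal.ofReal_prod_of_nonneg
      fun i _ => (Real.exp_pos _).le]
    refine Finset.prod_congr rfl fun i _ => ?_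
    rw [gammaPDF_of_nonneg (hE i).le]
    simp
  rw [hlim]
  refine (ENNReal.continuous_ofReal.tendsto _).comp
    (((tendsto_descFactorial_mul_gapScale (f a) N).mul ?_).mul
      (hf.tendsto_measureReal_Ioi_pow hc ha N (sum_Iic_pos hE _).le))
  exact tendsto_finsetProd _ fun i _ => hc.tendsto.comp (hmem i)

end TypeLaw

/-! ### First-order expansion of the payoff from waiting -/

section Events

variable {ι : Type*} [Fintype ι]

theorem countLT_eq_zero {x : ι → ℝ} {c : ℝ} (h : ∀ i, c ≤ x i) : countLT x c = 0 := by
  rw [countLT, Finset.card_eq_zero, Finset.filter_eq_empty_iff]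
  exact fun i _ => (h i).not_gt

theorem countLE_eq_zero {x : ι → ℝ} {c : ℝ} (h : ∀ i, c < x i) : countLE x c = 0 := by
  rw [countLE, Finset.card_eq_zero, Finset.filter_eq_empty_iff]
  exact fun i _ => (h i).not_ge

theorem countLT_eq_one {x : ι → ℝ} {c : ℝ} (i : ι) (hi : x i < c) (h : ∀ j, j ≠ i → c ≤ x j) :
    countLT x c = 1 := by
  rw [countLT, Finset.card_eq_one]
  refine ⟨i, ?_⟩
  ext j
  simp only [Finset.mem_filter, Finset.mem_univ, true_and, Finset.mem_singleton]
  exact ⟨fun hj => by_contra fun hne => (h j hne).not_gt hj, fun hj => hj ▸ hi⟩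

theorem countLE_eq_one {x : ι → ℝ} {c : ℝ} (i : ι) (hi : x i ≤ c) (h : ∀ j, j ≠ i → c < x j) :
    countLE x c = 1 := by
  rw [countLE, Finset.card_eq_one]
  refine ⟨i, ?_⟩
  ext j
  simp only [Finset.mem_filter, Finset.mem_univ, true_and, Finset.mem_singleton]
  exact ⟨fun hj => by_contra fun hne => (h j hne).not_ge hj, fun hj => hj ▸ hi⟩

/-- The first-order effect of the entrants `e` (own side) and `e'` (other side) on the partner of
an agent of type `c` whose first-period partner has type `y₀`, with neighbours `L` below and `y₁`
above: each entrant below `c` moves the partner up to `y₁`, each one `v` below `y₀` moves it down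
to `max L v`. -/
noncomputable def firstOrderEffect {k : ℕ} (c L y₀ y₁ : ℝ) (e e' : Fin k → ℝ) : ℝ :=
  (∑ i, (Iio c).indicator (fun _ => y₁ - y₀) (e i)) -
    ∑ j, (Iio y₀).indicator (fun v => y₀ - max L v) (e' j)

/-- At least two of the `2 k` entrants arrive below `c` (own side) or `y₁` (other side). -/
def TwoArrivals {k : ℕ} (c y₁ : ℝ) (e e' : Fin k → ℝ) : Prop :=
  ∃ i j : Fin k ⊕ Fin k, i ≠ j ∧ (Sum.elim (fun i => e i < c) (fun i => e' i < y₁)) i ∧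
    (Sum.elim (fun i => e i < c) (fun i => e' i < y₁)) j

theorem sum_eq_single_indicator {k : ℕ} {s : Set ℝ} {G : ℝ → ℝ} {e : Fin k → ℝ} (i : Fin k)
    (h : ∀ j, j ≠ i → e j ∉ s) : ∑ j, s.indicator G (e j) = s.indicator G (e i) :=
  Finset.sum_eq_single i (fun j _ hj => indicator_of_notMem (h j hj) _) (by simp)

theorem sum_indicator_eq_zero {k : ℕ} {s : Set ℝ} {G : ℝ → ℝ} {e : Fin k → ℝ}
    (h : ∀ j, e j ∉ s) : ∑ j, s.indicator G (e j) = 0 :=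
  Finset.sum_eq_zero fun j _ => indicator_of_notMem (h j) _

variable {N k : ℕ} {x y : Fin (N + 1) → ℝ} {p : Fin (N + 1)} {a' L y₁ : ℝ} {e e' : Fin k → ℝ}

theorem lt_countLE_of_strictMono (hy : StrictMono y) (q : Fin (N + 1)) (t : ℝ) :
    (q : ℕ) < countLE y t ↔ y q ≤ t := by
  rw [lt_countLE_iff, sort_eq_refl hy.monotone]
  rfl

theorem partnerType_le_of_strictMono (hx : StrictMono x) (he : ∀ j, e j ≠ x p) (t : ℝ) :
    partnerType (Fin.append x e) (Fin.append y e') (Fin.castAdd k p) ≤ t ↔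
      p + countLT e (x p) < countLE y t + countLE e' t := by
  rw [partnerType_append_le_iff y e' (fun i h => hx.injective h) he, countLT_strictMono hx]

/-- Unless two entrants arrive, the first-order effect is exact. The hypothesis on `L` says that `L`
is the type below `y p`, or the endpoint `a'` if `p = 0`; an entrant on the other side lies above
`a'`, so that the value `max L v` is right in both cases. -/
theorem partnerType_eq_firstOrder (hx : StrictMono x) (hy : StrictMono y)
    (hL : ∀ t, a' ≤ t → (L ≤ t ↔ (p : ℕ) ≤ countLE y t)) (hLy : L ≤ y p)
    (hy₁ : ∀ t, y₁ ≤ t ↔ (p : ℕ) + 1 < countLE y t) (hlt : y p < y₁)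
    (he : ∀ j, e j ≠ x p) (he' : ∀ j, a' ≤ e' j) (h2 : ¬ TwoArrivals (x p) y₁ e e') :
    partnerType (Fin.append x e) (Fin.append y e') (Fin.castAdd k p) =
      y p + firstOrderEffect (x p) L (y p) y₁ e e' := by
  have hp := fun t => lt_countLE_of_strictMono hy p t
  have hone : ∀ i j : Fin k ⊕ Fin k, (Sum.elim (fun i => e i < x p) (fun i => e' i < y₁)) i →
      j ≠ i → ¬ (Sum.elim (fun i => e i < x p) (fun i => e' i < y₁)) j :=
    fun i j hi hne hj => h2 ⟨i, j, hne.symm, hi, hj⟩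
  refine eq_of_forall_ge_iff fun t => ?_
  rw [partnerType_le_of_strictMono hx he]
  have hy₁t := hy₁ t
  have hpt := hp t
  by_cases h : ∃ i, (Sum.elim (fun i => e i < x p) (fun i => e' i < y₁)) i
  · obtain ⟨i | j, hi⟩ := h
    · -- one entrant on the own side
      have h3 : ∀ l, l ≠ i → x p ≤ e l := fun l hl => not_lt.1 fun h =>
        hone (Sum.inl i) (Sum.inl l) hi (by simpa using hl) h
      have h4 : ∀ l, y₁ ≤ e' l := fun l => not_lt.1 fun h =>
        hone (Sum.inl i) (Sum.inr l) hi (by simp) h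
      rw [firstOrderEffect, sum_eq_single_indicator i fun l hl => (h3 l hl).not_gt,
        sum_indicator_eq_zero fun l => (hlt.le.trans (h4 l)).not_gt, countLT_eq_one i hi h3,
        indicator_of_mem (show e i ∈ Iio (x p) from hi)]
      rcases lt_or_ge t y₁ with ht | ht
      · rw [countLE_eq_zero fun l => ht.trans_le (h4 l)]
        have := not_le.2 ht
        constructor
        · intro h; exact absurd (hy₁t.2 (by omega)) this
        · intro h; linarith
      · have := hy₁t.1 ht
        constructor
        · intro _; linarith
        · intro _; omega
    · -- one entrant on the other side
      have h3 : ∀ l, l ≠ j → y₁ ≤ e' l := fun l hl => not_lt.1 fun h =>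
        hone (Sum.inr j) (Sum.inr l) hi (by simpa using hl) h
      have h4 : ∀ l, x p ≤ e l := fun l => not_lt.1 fun h =>
        hone (Sum.inr j) (Sum.inl l) hi (by simp) h
      have hi' : e' j < y₁ := hi
      rw [firstOrderEffect, sum_indicator_eq_zero fun l => (h4 l).not_gt,
        sum_eq_single_indicator j fun l hl => (hlt.le.trans (h3 l hl)).not_gt, countLT_eq_zero h4]
      rcases lt_or_ge t y₁ with ht | ht
      · have h5 : e' j ≤ t → countLE e' t = 1 := fun hjt =>
          countLE_eq_one j hjt fun l hl => ht.trans_le (h3 l hl)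
        have h6 : ¬ e' j ≤ t → countLE e' t = 0 := fun hjt => countLE_eq_zero fun l => by
          by_cases hl : l = j
          · rw [hl]; exact not_le.1 hjt
          · exact ht.trans_le (h3 l hl)
        by_cases hjt : e' j ≤ t
        · rw [h5 hjt]
          have hLt := hL t ((he' j).trans hjt)
          by_cases hjy : e' j < y p
          · rw [indicator_of_mem (show e' j ∈ Iio (y p) from hjy)]
            have : y p + (0 - (y p - max L (e' j))) ≤ t ↔ L ≤ t := by
              rw [show y p + (0 - (y p - max L (e' j))) = max L (e' j) by ring, max_le_iff]
              exact and_iff_left hjt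
            rw [this, hLt]
            omega
          · rw [indicator_of_notMem (show e' j ∉ Iio (y p) from hjy)]
            have : y p ≤ t := (not_lt.1 hjy).trans hjt
            have := hpt.2 this
            constructor
            · intro _; linarith
            · intro _; omega
        · rw [h6 hjt]
          by_cases hjy : e' j < y p
          · rw [indicator_of_mem (show e' j ∈ Iio (y p) from hjy)]
            have h7 : ¬ y p ≤ t := fun h => hjt (hjy.le.trans h)
            constructor
            · intro h; exact absurd (hpt.1 (by omega)) h7
            · intro h
              have := le_max_right L (e' j)
              exact absurd (by linarith) hjt
          · rw [indicator_of_notMem (show e' j ∉ Iio (y p) from hjy)]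
            simpa only [sub_zero, add_zero] using hpt
      · have h5 := hy₁t.1 ht
        have h6 : (Iio (y p)).indicator (fun v => y p - max L v) (e' j) ≥ 0 :=
          indicator_nonneg (fun v hv => sub_nonneg.2 (max_le hLy (le_of_lt hv))) _
        constructor
        · intro _; linarith
        · intro _; omega
  · push Not at h
    have h3 : ∀ l, x p ≤ e l := fun l => not_lt.1 fun hl => h (Sum.inl l) hl
    have h4 : ∀ l, y₁ ≤ e' l := fun l => not_lt.1 fun hl => h (Sum.inr l) hl
    rw [firstOrderEffect, sum_indicator_eq_zero fun l => (h3 l).not_gt,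
      sum_indicator_eq_zero fun l => (hlt.le.trans (h4 l)).not_gt, countLT_eq_zero h3,
      sub_zero, add_zero, add_zero, ← hpt]
    rcases lt_or_ge t y₁ with ht | ht
    · rw [countLE_eq_zero fun l => ht.trans_le (h4 l)]
      rfl
    · have h5 := hy₁t.1 ht
      omega

/-- The partner always lies between the endpoint `a'` and the type `Y` of rank `p + k`. -/
theorem partnerType_mem_Icc (hx : StrictMono x) (hya : ∀ i, a' ≤ y i) {Y : ℝ}
    (hY : (p : ℕ) + k < countLE y Y) (he : ∀ j, e j ≠ x p) (he' : ∀ j, a' ≤ e' j) :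
    partnerType (Fin.append x e) (Fin.append y e') (Fin.castAdd k p) ∈ Icc a' Y := by
  have hk : countLT e (x p) ≤ k := by simpa using countLT_le e (x p)
  constructor
  · by_contra h
    have h1 := (partnerType_le_of_strictMono (y := y) (e' := e') hx he _).1 le_rfl
    rw [countLE_eq_zero fun l => (not_le.1 h).trans_le (hya l),
      countLE_eq_zero fun l => (not_le.1 h).trans_le (he' l)] at h1
    omega
  · exact (partnerType_le_of_strictMono (y := y) (e' := e') hx he _).2 (by omega)

theorem abs_firstOrderEffect_le {c L y₀ y₁ a' Y : ℝ} (hL : a' ≤ L) (hLy : L ≤ y₀) (h01 : y₀ ≤ y₁)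
    (h1Y : y₁ ≤ Y) (e e' : Fin k → ℝ) :
    |firstOrderEffect c L y₀ y₁ e e'| ≤ 2 * k * (Y - a') := by
  have h1 : |∑ i, (Iio c).indicator (fun _ => y₁ - y₀) (e i)| ≤ k * (Y - a') := by
    refine (Finset.abs_sum_le_sum_abs _ _).trans ?_
    refine (Finset.sum_le_sum (g := fun _ => Y - a') fun i _ => ?_).trans
      (le_of_eq (by rw [Finset.sum_const, Finset.card_univ, Fintype.card_fin, nsmul_eq_mul]))
    by_cases h : e i ∈ Iio c
    · rw [indicator_of_mem h, abs_le]; constructor <;> linarith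
    · rw [indicator_of_notMem h, abs_zero]; linarith
  have h2 : |∑ j, (Iio y₀).indicator (fun v => y₀ - max L v) (e' j)| ≤ k * (Y - a') := by
    refine (Finset.abs_sum_le_sum_abs _ _).trans ?_
    refine (Finset.sum_le_sum (g := fun _ => Y - a') fun i _ => ?_).trans
      (le_of_eq (by rw [Finset.sum_const, Finset.card_univ, Fintype.card_fin, nsmul_eq_mul]))
    by_cases h : e' i ∈ Iio y₀
    · have h3 := le_max_left L (e' i)
      have h4 : max L (e' i) ≤ y₀ := max_le hLy (le_of_lt h)
      rw [indicator_of_mem h, abs_le]; constructor <;> linarith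
    · rw [indicator_of_notMem h, abs_zero]; linarith
  have := abs_sub (∑ i, (Iio c).indicator (fun _ => y₁ - y₀) (e i))
    (∑ j, (Iio y₀).indicator (fun v => y₀ - max L v) (e' j))
  rw [firstOrderEffect]
  linarith

end Events

section Expansion

variable (k : ℕ) (P Q : Measure ℝ) [IsProbabilityMeasure P] [IsProbabilityMeasure Q]

/-- The joint law of the types of the entrants of both sides. -/
noncomputable abbrev entrantLaw : Measure ((Fin k → ℝ) × (Fin k → ℝ)) :=
  (Measure.pi fun _ : Fin k => P).prod (Measure.pi fun _ : Fin k => Q)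

theorem measurePreserving_entrant_fst (i : Fin k) :
    MeasurePreserving (fun e : (Fin k → ℝ) × (Fin k → ℝ) => e.1 i) (entrantLaw k P Q) P :=
  (measurePreserving_eval (fun _ : Fin k => P) i).comp measurePreserving_fst

theorem measurePreserving_entrant_snd (i : Fin k) :
    MeasurePreserving (fun e : (Fin k → ℝ) × (Fin k → ℝ) => e.2 i) (entrantLaw k P Q) Q :=
  (measurePreserving_eval (fun _ : Fin k => Q) i).comp measurePreserving_snd

theorem pi_two_coordinates {n : ℕ} (P : Measure ℝ) [IsProbabilityMeasure P] {i j : Fin n}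
    (hij : i ≠ j) (c : ℝ) :
    (Measure.pi fun _ : Fin n => P).real {x | x i < c ∧ x j < c} = P.real (Iio c) ^ 2 := by
  have h1 := (iIndepFun_pi (μ := fun _ : Fin n => P) (X := fun _ x => x)
    (fun _ => aemeasurable_id)).indepFun hij
  have h2 := h1.measure_inter_preimage_eq_mul (Iio c) (Iio c) measurableSet_Iio measurableSet_Iio
  have h3 := (measurePreserving_eval (fun _ : Fin n => P) i).measure_preimage
    (measurableSet_Iio (a := c)).nullMeasurableSet
  have h4 := (measurePreserving_eval (fun _ : Fin n => P) j).measure_preimage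
    (measurableSet_Iio (a := c)).nullMeasurableSet
  have h5 : (Measure.pi fun _ : Fin n => P) {x | x i < c ∧ x j < c} = P (Iio c) * P (Iio c) := by
    refine Eq.trans ?_ (h2.trans (congr_arg₂ _ h3 h4))
    rfl
  rw [measureReal_def, h5, ENNReal.toReal_mul, sq]
  rfl

/-- A union bound over pairs of entrants, who are independent. -/
theorem measureReal_twoArrivals_le (c y₁ : ℝ) :
    (entrantLaw k P Q).real {e | TwoArrivals c y₁ e.1 e.2} ≤
      (2 * k) ^ 2 * (P.real (Iio c) + Q.real (Iio y₁)) ^ 2 := by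
  set M := entrantLaw k P Q
  set ρ := P.real (Iio c) + Q.real (Iio y₁)
  have hP : 0 ≤ P.real (Iio c) := measureReal_nonneg
  have hQ : 0 ≤ Q.real (Iio y₁) := measureReal_nonneg
  set Ev : (Fin k ⊕ Fin k) → ((Fin k → ℝ) × (Fin k → ℝ)) → Prop := fun i e =>
    (Sum.elim (fun i => e.1 i < c) (fun i => e.2 i < y₁)) i
  have hpair : ∀ i j, i ≠ j → M.real {e | Ev i e ∧ Ev j e} ≤ ρ ^ 2 := by
    rintro (i | i) (j | j) hij
    · have : {e : (Fin k → ℝ) × (Fin k → ℝ) | Ev (Sum.inl i) e ∧ Ev (Sum.inl j) e} =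
          {x | x i < c ∧ x j < c} ×ˢ univ := by
        ext e; simp [Ev]
      rw [this, measureReal_prod_prod, pi_two_coordinates P (by simpa using hij)]
      simp only [probReal_univ, mul_one]
      exact pow_le_pow_left₀ hP (by simp [ρ]) 2
    · have : {e : (Fin k → ℝ) × (Fin k → ℝ) | Ev (Sum.inl i) e ∧ Ev (Sum.inr j) e} =
          (Function.eval i ⁻¹' Iio c) ×ˢ (Function.eval j ⁻¹' Iio y₁) := by
        ext e; simp [Ev]
      rw [this, measureReal_prod_prod,
        (measurePreserving_eval (fun _ : Fin k => P) i).measureReal_preimage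
          measurableSet_Iio.nullMeasurableSet,
        (measurePreserving_eval (fun _ : Fin k => Q) j).measureReal_preimage
          measurableSet_Iio.nullMeasurableSet, sq]
      exact mul_le_mul (by simp [ρ]) (by simp [ρ]) hQ (add_nonneg hP hQ)
    · have : {e : (Fin k → ℝ) × (Fin k → ℝ) | Ev (Sum.inr i) e ∧ Ev (Sum.inl j) e} =
          (Function.eval j ⁻¹' Iio c) ×ˢ (Function.eval i ⁻¹' Iio y₁) := by
        ext e; simp [Ev, and_comm]
      rw [this, measureReal_prod_prod,
        (measurePreserving_eval (fun _ : Fin k => P) j).measureReal_preimage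
          measurableSet_Iio.nullMeasurableSet,
        (measurePreserving_eval (fun _ : Fin k => Q) i).measureReal_preimage
          measurableSet_Iio.nullMeasurableSet, sq]
      exact mul_le_mul (by simp [ρ]) (by simp [ρ]) hQ (add_nonneg hP hQ)
    · have : {e : (Fin k → ℝ) × (Fin k → ℝ) | Ev (Sum.inr i) e ∧ Ev (Sum.inr j) e} =
          univ ×ˢ {x | x i < y₁ ∧ x j < y₁} := by
        ext e; simp [Ev]
      rw [this, measureReal_prod_prod, pi_two_coordinates Q (by simpa using hij)]
      simp only [probReal_univ, one_mul]
      exact pow_le_pow_left₀ hQ (by simp [ρ]) 2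
  have hsub : {e : (Fin k → ℝ) × (Fin k → ℝ) | TwoArrivals c y₁ e.1 e.2} ⊆
      ⋃ ij ∈ (Finset.univ.filter fun ij : (Fin k ⊕ Fin k) × (Fin k ⊕ Fin k) => ij.1 ≠ ij.2),
        {e | Ev ij.1 e ∧ Ev ij.2 e} := by
    rintro e ⟨i, j, hij, hi, hj⟩
    simp only [mem_iUnion]
    exact ⟨(i, j), by simpa using hij, hi, hj⟩
  refine (measureReal_mono hsub (measure_ne_top _ _)).trans
    ((measureReal_biUnion_finset_le _ _).trans ?_)
  refine (Finset.sum_le_card_nsmul _ _ (ρ ^ 2) fun ij hij => hpair _ _ ?_).trans ?_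
  · simpa using hij
  · rw [nsmul_eq_mul]
    refine mul_le_mul_of_nonneg_right ?_ (sq_nonneg _)
    have : (Finset.univ.filter fun ij : (Fin k ⊕ Fin k) × (Fin k ⊕ Fin k) => ij.1 ≠ ij.2).card ≤
        (2 * k) ^ 2 := by
      refine (Finset.card_le_univ _).trans ?_
      simp only [Fintype.card_prod, Fintype.card_sum, Fintype.card_fin]
      exact le_of_eq (by ring)
    exact_mod_cast this

theorem measurableSet_twoArrivals (c y₁ : ℝ) :
    MeasurableSet {e : (Fin k → ℝ) × (Fin k → ℝ) | TwoArrivals c y₁ e.1 e.2} := by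
  have : {e : (Fin k → ℝ) × (Fin k → ℝ) | TwoArrivals c y₁ e.1 e.2} =
      ⋃ i, ⋃ j, ⋃ (_ : i ≠ j),
        ({e | (Sum.elim (fun i => e.1 i < c) (fun i => e.2 i < y₁)) i} ∩
        {e | (Sum.elim (fun i => e.1 i < c) (fun i => e.2 i < y₁)) j}) := by
    ext e
    simp only [TwoArrivals, mem_ofPred_eq, mem_iUnion, mem_inter_iff, exists_prop]
  have hm : ∀ i : Fin k ⊕ Fin k, MeasurableSet {e : (Fin k → ℝ) × (Fin k → ℝ) |
      (Sum.elim (fun i => e.1 i < c) (fun i => e.2 i < y₁)) i} := by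
    rintro (i | i)
    · exact measurableSet_lt (f := fun e : (Fin k → ℝ) × (Fin k → ℝ) => e.1 i) (by fun_prop)
        measurable_const
    · exact measurableSet_lt (f := fun e : (Fin k → ℝ) × (Fin k → ℝ) => e.2 i) (by fun_prop)
        measurable_const
  rw [this]
  exact MeasurableSet.iUnion fun i => MeasurableSet.iUnion fun j => MeasurableSet.iUnion fun _ =>
    (hm i).inter (hm j)

theorem measurable_effect_below {L y₀ : ℝ} :
    Measurable ((Iio y₀).indicator fun v => y₀ - max L v) :=
  Measurable.indicator (by fun_prop) measurableSet_Iio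

theorem measurable_firstOrderEffect (c L y₀ y₁ : ℝ) : Measurable
    fun e : (Fin k → ℝ) × (Fin k → ℝ) => firstOrderEffect c L y₀ y₁ e.1 e.2 := by
  unfold firstOrderEffect
  have h1 : Measurable ((Iio c).indicator fun _ => y₁ - y₀) :=
    measurable_const.indicator measurableSet_Iio
  have h2 := measurable_effect_below (L := L) (y₀ := y₀)
  exact (Finset.measurable_sum _ fun i _ => h1.comp (by fun_prop)).sub
    (Finset.measurable_sum _ fun i _ => h2.comp (by fun_prop))

theorem integral_firstOrderEffect {c L y₀ y₁ : ℝ} (hLy : L ≤ y₀) :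
    ∫ e, firstOrderEffect c L y₀ y₁ e.1 e.2 ∂(entrantLaw k P Q) =
      k * ((y₁ - y₀) * P.real (Iio c) - ∫ v in Iio y₀, (y₀ - max L v) ∂Q) := by
  have hm1 : Measurable ((Iio c).indicator fun _ => y₁ - y₀) :=
    measurable_const.indicator measurableSet_Iio
  have hm2 := measurable_effect_below (L := L) (y₀ := y₀)
  have hb2 : ∀ v, ‖(Iio y₀).indicator (fun v => y₀ - max L v) v‖ ≤ y₀ - L := fun v => by
    by_cases h : v ∈ Iio y₀
    · have h3 := le_max_left L v
      have h4 : max L v ≤ y₀ := max_le hLy (le_of_lt h)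
      rw [indicator_of_mem h, Real.norm_eq_abs, abs_le]; constructor <;> linarith
    · rw [indicator_of_notMem h, norm_zero]; linarith
  have hb1 : ∀ v, ‖(Iio c).indicator (fun _ => y₁ - y₀) v‖ ≤ ‖y₁ - y₀‖ := fun v =>
    norm_indicator_le_norm_self _ _
  have hi1 : ∀ i : Fin k, Integrable (fun e : (Fin k → ℝ) × (Fin k → ℝ) =>
      (Iio c).indicator (fun _ => y₁ - y₀) (e.1 i)) (entrantLaw k P Q) := fun i =>
    Integrable.of_bound (hm1.comp (by fun_prop)).aestronglyMeasurable _
      (ae_of_all _ fun e => hb1 _)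
  have hi2 : ∀ i : Fin k, Integrable (fun e : (Fin k → ℝ) × (Fin k → ℝ) =>
      (Iio y₀).indicator (fun v => y₀ - max L v) (e.2 i)) (entrantLaw k P Q) := fun i =>
    Integrable.of_bound (hm2.comp (by fun_prop)).aestronglyMeasurable _
      (ae_of_all _ fun e => hb2 _)
  have e1 : ∀ i : Fin k, ∫ e, (Iio c).indicator (fun _ => y₁ - y₀) (e.1 i) ∂(entrantLaw k P Q) =
      (y₁ - y₀) * P.real (Iio c) := fun i => by
    have hmp := measurePreserving_entrant_fst k P Q i
    have := integral_map (μ := entrantLaw k P Q) hmp.measurable.aemeasurable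
      (f := (Iio c).indicator fun _ => y₁ - y₀) hm1.aestronglyMeasurable
    rw [← this, hmp.map_eq, integral_indicator_const _ measurableSet_Iio, smul_eq_mul, mul_comm]
  have e2 : ∀ i : Fin k, ∫ e, (Iio y₀).indicator (fun v => y₀ - max L v) (e.2 i)
      ∂(entrantLaw k P Q) = ∫ v in Iio y₀, (y₀ - max L v) ∂Q := fun i => by
    have hmp := measurePreserving_entrant_snd k P Q i
    have := integral_map (μ := entrantLaw k P Q) hmp.measurable.aemeasurable
      (f := (Iio y₀).indicator fun v => y₀ - max L v) hm2.aestronglyMeasurable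
    rw [← this, hmp.map_eq, integral_indicator measurableSet_Iio]
  unfold firstOrderEffect
  rw [integral_sub (integrable_finsetSum _ fun i _ => hi1 i)
    (integrable_finsetSum _ fun i _ => hi2 i), integral_finsetSum _ fun i _ => hi1 i,
    integral_finsetSum _ fun i _ => hi2 i]
  simp only [e1, e2, Finset.sum_const, Finset.card_univ, Fintype.card_fin, nsmul_eq_mul]
  ring

/-- The payoff from waiting equals its first-order expansion up to a multiple of the probability
that two entrants arrive. Here `L` is the type below `y p`, or the endpoint `a'` if `p = 0`, `y₁` is
the type above it and `Y` that of rank `p + k`; they are characterised by counting, which treats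
`p = 0` on the same footing. -/
theorem abs_waitingPayoff_sub_le [NullSingletonClass P] {N : ℕ} {x y : Fin (N + 1) → ℝ}
    {p : Fin (N + 1)} {a' L y₁ Y : ℝ} (hx : StrictMono x) (hy : StrictMono y)
    (hya : ∀ i, a' ≤ y i) (hQ : ∀ᵐ v ∂Q, a' ≤ v)
    (hL : ∀ t, a' ≤ t → (L ≤ t ↔ (p : ℕ) ≤ countLE y t)) (haL : a' ≤ L) (hLy : L ≤ y p)
    (hy₁ : ∀ t, y₁ ≤ t ↔ (p : ℕ) + 1 < countLE y t) (hlt : y p < y₁) (h1Y : y₁ ≤ Y)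
    (hY : (p : ℕ) + k < countLE y Y) :
    |waitingPayoff k P Q x y p - y p -
        k * ((y₁ - y p) * P.real (Iio (x p)) - ∫ v in Iio (y p), (y p - max L v) ∂Q)| ≤
      (2 * k + 1) * (Y - a') * ((2 * k) ^ 2 * (P.real (Iio (x p)) + Q.real (Iio y₁)) ^ 2) := by
  set M := entrantLaw k P Q
  set D : (Fin k → ℝ) × (Fin k → ℝ) → ℝ := fun e =>
    partnerType (Fin.append x e.1) (Fin.append y e.2) (Fin.castAdd k p)
  set S : (Fin k → ℝ) × (Fin k → ℝ) → ℝ := fun e => firstOrderEffect (x p) L (y p) y₁ e.1 e.2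
  set T : Set ((Fin k → ℝ) × (Fin k → ℝ)) := {e | TwoArrivals (x p) y₁ e.1 e.2}
  have hTm : MeasurableSet T := measurableSet_twoArrivals k (x p) y₁
  have hae : ∀ᵐ e ∂M, (∀ j, e.1 j ≠ x p) ∧ ∀ j, a' ≤ e.2 j := by
    have h1 : ∀ᵐ e ∂M, ∀ j, e.1 j ≠ x p :=
      Measure.quasiMeasurePreserving_fst.ae (ae_pi_forall_ne P k (x p))
    have h2 : ∀ᵐ e ∂M, ∀ j, a' ≤ e.2 j := ae_all_iff.2 fun j =>
      (measurePreserving_entrant_snd k P Q j).quasiMeasurePreserving.ae hQ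
    exact h1.and h2
  have hDm : Measurable D := (measurable_partnerType _).comp
    ((measurable_append (by fun_prop) (by fun_prop)).prodMk
      (measurable_append (by fun_prop) (by fun_prop)))
  have hSm : Measurable S := measurable_firstOrderEffect k _ _ _ _
  have hS : ∀ e, |S e| ≤ 2 * k * (Y - a') := fun e =>
    abs_firstOrderEffect_le haL hLy hlt.le h1Y e.1 e.2
  have hD : ∀ᵐ e ∂M, |D e - y p| ≤ Y - a' := by
    filter_upwards [hae] with e he
    have h1 := partnerType_mem_Icc hx hya hY he.1 he.2
    have h2 := hya p
    rw [abs_le]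
    constructor <;> linarith [h1.1, h1.2]
  have hDi : Integrable (fun e => D e - y p) M :=
    Integrable.of_bound (hDm.sub_const _).aestronglyMeasurable _ hD
  have hDi' : Integrable D M :=
    (hDi.add (integrable_const (y p))).congr (ae_of_all _ fun e => by simp)
  have hSi : Integrable S M :=
    Integrable.of_bound hSm.aestronglyMeasurable _ (ae_of_all _ hS)
  have key : ∀ᵐ e ∂M, |D e - y p - S e| ≤ T.indicator (fun _ => (2 * k + 1) * (Y - a')) e := by
    filter_upwards [hae, hD] with e he hDe
    by_cases hT : e ∈ T
    · rw [indicator_of_mem hT]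
      have := abs_sub (D e - y p) (S e)
      have := hS e
      linarith
    · rw [indicator_of_notMem hT, show D e = y p + S e from
        partnerType_eq_firstOrder hx hy hL hLy hy₁ hlt he.1 he.2 hT]
      simp
  have hW : waitingPayoff k P Q x y p - y p - k * ((y₁ - y p) * P.real (Iio (x p)) -
      ∫ v in Iio (y p), (y p - max L v) ∂Q) = ∫ e, (D e - y p - S e) ∂M := by
    rw [integral_sub hDi hSi, integral_sub hDi' (integrable_const _),
      ← integral_firstOrderEffect k P Q hLy]
    simp only [integral_const, probReal_univ, one_smul]
    rfl
  rw [hW]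
  refine (abs_integral_le_integral_abs).trans ?_
  refine (integral_mono_ae (hDi.sub hSi).abs
    ((integrable_const _).indicator hTm) key).trans ?_
  rw [integral_indicator_const _ hTm, smul_eq_mul, mul_comm]
  refine mul_le_mul_of_nonneg_left (measureReal_twoArrivals_le k P Q _ _) ?_
  have : a' ≤ Y := haL.trans (hLy.trans (hlt.le.trans h1Y))
  exact mul_nonneg (by positivity) (by linarith)

end Expansion

/-! ### The leading term of the gain from waiting -/

section PointwiseLimit

theorem integral_sub_max {A b : ℝ} (hA : 0 ≤ A) (hb : 0 ≤ b) :
    ∫ s in (0:ℝ)..(A + b), (A + b - max A s) = A * b + b ^ 2 / 2 := by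
  have hc : Continuous fun s : ℝ => A + b - max A s := by fun_prop
  rw [← intervalIntegral.integral_add_adjacent_intervals (b := A) (hc.intervalIntegrable _ _)
    (hc.intervalIntegrable _ _)]
  have h1 : ∫ s in (0:ℝ)..A, (A + b - max A s) = ∫ _s in (0:ℝ)..A, b := by
    refine intervalIntegral.integral_congr fun s hs => ?_
    rw [uIcc_of_le hA] at hs
    simp [max_eq_left hs.2]
  have h2 : ∫ s in A..(A + b), (A + b - max A s) = ∫ s in A..(A + b), (A + b - s) := by
    refine intervalIntegral.integral_congr fun s hs => ?_
    rw [uIcc_of_le (by linarith)] at hs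
    simp [max_eq_right hs.1]
  rw [h1, h2, intervalIntegral.integral_sub intervalIntegrable_const
    intervalIntegral.intervalIntegrable_id]
  simp
  ring

/-- From the gaps between consecutive types: the distance of the type of rank `p - 1` from the
endpoint, and the gaps below and above the type of rank `p`, where `p₁ = p + 1`. -/
def gapTriple {N : ℕ} (p p₁ : Fin (N + 1)) (E : Fin (N + 1) → ℝ) : ℝ × ℝ × ℝ :=
  (∑ j ∈ Finset.Iio p, E j, E p, E p₁)

theorem measurable_gapTriple {N : ℕ} (p p₁ : Fin (N + 1)) : Measurable (gapTriple p p₁) := by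
  unfold gapTriple; fun_prop

theorem sum_Iic_eq {N : ℕ} (p : Fin (N + 1)) (E : Fin (N + 1) → ℝ) :
    ∑ j ∈ Finset.Iic p, E j = ∑ j ∈ Finset.Iio p, E j + E p := by
  have : Finset.Iic p = insert p (Finset.Iio p) := by
    ext i; simp [le_iff_lt_or_eq, or_comm]
  rw [this, Finset.sum_insert (by simp), add_comm]

theorem Iio_eq_Iic {N : ℕ} {p q : Fin (N + 1)} (h : (p : ℕ) = q + 1) :
    Finset.Iio p = Finset.Iic q := by
  ext i
  simp only [Finset.mem_Iio, Finset.mem_Iic, Fin.lt_def, Fin.le_def]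
  omega

variable {f g : ℝ → ℝ} {a b a' b' : ℝ}

/-- For fixed gaps, the gain from waiting is of order `n⁻²`, with the scaled gain of the gap
triples as leading coefficient: with probability of order `n⁻¹` a single entrant shifts the
partner, by an amount of order `n⁻¹`, and two entrants contribute only `n⁻³`. -/
theorem tendsto_waitingPayoff (hf : IsDensityOn f a b) (hfc : ContinuousWithinAt f (Icc a b) a)
    (hfa : 0 < f a) (hg : IsDensityOn g a' b') (hgc : ContinuousWithinAt g (Icc a' b') a')
    (hga : 0 < g a') (k : ℕ) {N : ℕ} {p p₁ pk : Fin (N + 1)} (hp₁ : (p₁ : ℕ) = p + 1)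
    (hpk : (pk : ℕ) = p + k) (hk : 1 ≤ k) {E E' : Fin (N + 1) → ℝ} (hE : ∀ i, 0 < E i)
    (hE' : ∀ i, 0 < E' i) :
    Tendsto (fun m : ℕ => ((N + 1 + m : ℕ) : ℝ) ^ 2 * g a' *
      (waitingPayoff k (typeLaw f a b) (typeLaw g a' b') (pointsOfGaps a (gapScale (f a) N m) E)
        (pointsOfGaps a' (gapScale (g a') N m) E') p - pointsOfGaps a' (gapScale (g a') N m) E' p))
      atTop (𝓝 (k / 2 * scaledGain (gapTriple p p₁ E') (gapTriple p p₁ E))) := by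
  have := hf.isProbabilityMeasure
  have := hg.isProbabilityMeasure
  set P := typeLaw f a b
  set Q := typeLaw g a' b'
  set δ := gapScale (f a) N
  set δ' := gapScale (g a') N
  set U : Fin (N + 1) → ℝ := fun i => ∑ j ∈ Finset.Iic i, E j
  set V : Fin (N + 1) → ℝ := fun i => ∑ j ∈ Finset.Iic i, E' j with hV
  set A' : ℝ := ∑ j ∈ Finset.Iio p, E' j with hA'
  set n : ℕ → ℝ := fun m => ((N + 1 + m : ℕ) : ℝ)
  have hnpos : ∀ m, 0 < n m := fun m => by positivity
  have hδpos : ∀ m, 0 < δ m := gapScale_pos hfa N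
  have hδpos' : ∀ m, 0 < δ' m := gapScale_pos hga N
  have hδn : ∀ m, (δ m)⁻¹ = n m * f a := fun m => inv_inv _
  have hδn' : ∀ m, (δ' m)⁻¹ = n m * g a' := fun m => inv_inv _
  have hδ1 : ∀ m, n m * g a' * δ' m = 1 := fun m => by
    rw [← hδn']; exact inv_mul_cancel₀ (hδpos' m).ne'
  have hA'0 : 0 ≤ A' := Finset.sum_nonneg fun j _ => (hE' j).le
  have hVp : V p = A' + E' p := sum_Iic_eq p E'
  have hV₁ : V p₁ = A' + E' p + E' p₁ := by
    simp only [hV]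
    rw [sum_Iic_eq p₁ E', Iio_eq_Iic hp₁, sum_Iic_eq p E']
  have hVpos : ∀ i, 0 < V i := sum_Iic_pos hE'
  have hUpos : ∀ i, 0 < U i := sum_Iic_pos hE
  -- the probability, at the scale `1 / n`, that an entrant arrives on each side
  have hP : Tendsto (fun m => n m * P.real (Iio (a + δ m * U p))) atTop (𝓝 (U p)) := by
    have h1 := (hf.tendsto_scaled_measureReal hfc hδpos (tendsto_gapScale hfa N)
      (hUpos p).le).const_mul (f a)⁻¹
    rw [← mul_assoc, inv_mul_cancel₀ hfa.ne', one_mul] at h1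
    refine h1.congr fun m => ?_
    rw [hδn]
    field_simp
    rfl
  have hQ : Tendsto (fun m => n m * Q.real (Iio (a' + δ' m * V p₁))) atTop (𝓝 (V p₁)) := by
    have h1 := (hg.tendsto_scaled_measureReal hgc hδpos' (tendsto_gapScale hga N)
      (hVpos p₁).le).const_mul (g a')⁻¹
    rw [← mul_assoc, inv_mul_cancel₀ hga.ne', one_mul] at h1
    refine h1.congr fun m => ?_
    rw [hδn']
    field_simp
    rfl
  -- the loss from an entrant on the other side
  have hloss : Tendsto (fun m => n m ^ 2 * g a' * ∫ v in Iio (a' + δ' m * V p),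
      (a' + δ' m * V p - max (a' + δ' m * A') v) ∂Q) atTop (𝓝 (A' * E' p + E' p ^ 2 / 2)) := by
    have h1 := (hg.tendsto_scaled_setIntegral hgc hδpos' (tendsto_gapScale hga N)
      (ψ := fun s => V p - max A' s) (by fun_prop) (hVpos p).le).const_mul (g a')⁻¹
    rw [← mul_assoc, inv_mul_cancel₀ hga.ne', one_mul, hVp, integral_sub_max hA'0 (hE' p).le,
      ← hVp] at h1
    refine h1.congr fun m => ?_
    have h2 : ∫ v in Iio (a' + δ' m * V p), (a' + δ' m * V p - max (a' + δ' m * A') v) ∂Q =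
        δ' m * ∫ v in Iio (a' + δ' m * V p), (V p - max A' ((v - a') / δ' m)) ∂Q := by
      rw [← integral_const_mul]
      refine integral_congr_ae (ae_of_all _ fun v => ?_)
      have h3 : δ' m * max A' ((v - a') / δ' m) = max (a' + δ' m * A') v - a' := by
        rw [mul_max_of_nonneg _ _ (hδpos' m).le, mul_div_cancel₀ _ (hδpos' m).ne',
          ← max_sub_sub_right, add_sub_cancel_left]
      simp only
      rw [mul_sub, h3]
      ring
    rw [h2, hδn']
    have h4 := hδ1 m
    have h5 : (g a')⁻¹ * (n m * g a') = n m := by field_simp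
    rw [← mul_assoc, h5, ← mul_assoc,
      show n m ^ 2 * g a' * δ' m = n m * (n m * g a' * δ' m) by ring,
      h4, mul_one]
  have hmain : Tendsto (fun m => n m ^ 2 * g a' * (k * ((a' + δ' m * V p₁ - (a' + δ' m * V p)) *
      P.real (Iio (a + δ m * U p)) - ∫ v in Iio (a' + δ' m * V p),
        (a' + δ' m * V p - max (a' + δ' m * A') v) ∂Q))) atTop
      (𝓝 (k / 2 * scaledGain (gapTriple p p₁ E') (gapTriple p p₁ E))) := by
    have h1 := ((hP.const_mul (E' p₁)).sub hloss).const_mul (k : ℝ)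
    refine (h1.congr fun m => ?_).trans (le_of_eq ?_)
    · have h4 := hδ1 m
      have h5 : a' + δ' m * V p₁ - (a' + δ' m * V p) = δ' m * E' p₁ := by rw [hV₁, hVp]; ring
      have h6 : n m ^ 2 * g a' * (δ' m * E' p₁) = n m * E' p₁ := by
        calc _ = (n m * g a' * δ' m) * (n m * E' p₁) := by ring
          _ = _ := by rw [h4, one_mul]
      rw [h5]
      linear_combination (-(k:ℝ) * P.real (Iio (a + δ m * U p))) * h6
    · congr 1
      have : U p = ∑ j ∈ Finset.Iio p, E j + E p := sum_Iic_eq p E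
      simp only [scaledGain, gapTriple]
      rw [this]
      ring
  -- the error from two entrants is of order `n⁻³`
  have herr : Tendsto (fun m => n m ^ 2 * g a' * ((2 * k + 1) * (a' + δ' m * V pk - a') *
      ((2 * k) ^ 2 * (P.real (Iio (a + δ m * U p)) + Q.real (Iio (a' + δ' m * V p₁))) ^ 2)))
      atTop (𝓝 0) := by
    have hninv : Tendsto (fun m => (n m)⁻¹) atTop (𝓝 0) :=
      (tendsto_natCast_add_atTop N).inv_tendsto_atTop
    have h1 := ((hninv.mul ((hP.add hQ).pow 2)).const_mul
      ((2 * k + 1) * V pk * (2 * (k:ℝ)) ^ 2))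
    rw [zero_mul, mul_zero] at h1
    refine h1.congr fun m => ?_
    have h4 := hδ1 m
    have h5 := (hnpos m).ne'
    have h6 : (n m)⁻¹ * (n m * P.real (Iio (a + δ m * U p)) +
        n m * Q.real (Iio (a' + δ' m * V p₁))) ^ 2 = n m * (P.real (Iio (a + δ m * U p)) +
        Q.real (Iio (a' + δ' m * V p₁))) ^ 2 := by
      field_simp
    rw [h6]
    linear_combination (-(2 * k + 1) * V pk * (2 * (k:ℝ)) ^ 2 * n m *
      (P.real (Iio (a + δ m * U p)) + Q.real (Iio (a' + δ' m * V p₁))) ^ 2) * h4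
  have hbound : ∀ m, |n m ^ 2 * g a' *
      (waitingPayoff k P Q (pointsOfGaps a (δ m) E) (pointsOfGaps a' (δ' m) E') p -
        pointsOfGaps a' (δ' m) E' p) - n m ^ 2 * g a' * (k * ((a' + δ' m * V p₁ -
        (a' + δ' m * V p)) * P.real (Iio (a + δ m * U p)) - ∫ v in Iio (a' + δ' m * V p),
        (a' + δ' m * V p - max (a' + δ' m * A') v) ∂Q))| ≤
      n m ^ 2 * g a' * ((2 * k + 1) * (a' + δ' m * V pk - a') *
      ((2 * k) ^ 2 * (P.real (Iio (a + δ m * U p)) + Q.real (Iio (a' + δ' m * V p₁))) ^ 2)) := by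
    intro m
    have hpos : 0 < n m ^ 2 * g a' := mul_pos (pow_pos (hnpos m) 2) hga
    rw [← mul_sub, abs_mul, abs_of_pos hpos]
    refine mul_le_mul_of_nonneg_left ?_ hpos.le
    have hx := strictMono_pointsOfGaps a (hδpos m) hE
    have hy := strictMono_pointsOfGaps a' (hδpos' m) hE'
    have hlt : p < p₁ := by rw [Fin.lt_def]; omega
    have hle : p₁ ≤ pk := by rw [Fin.le_def]; omega
    have hyi : ∀ i, pointsOfGaps a' (δ' m) E' i = a' + δ' m * V i := fun i => rfl
    refine abs_waitingPayoff_sub_le k P Q (L := a' + δ' m * A') (y₁ := a' + δ' m * V p₁)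
      (Y := a' + δ' m * V pk) hx hy ?_ ?_ ?_ ?_ ?_ ?_ ?_ ?_ ?_
    · intro i
      rw [hyi]
      exact le_add_of_nonneg_right (mul_nonneg (hδpos' m).le (hVpos i).le)
    · exact ae_typeLaw_mem_Icc.mono fun v hv => hv.1
    · intro t ht
      rcases Nat.eq_zero_or_pos (p : ℕ) with h0 | h0
      · have : Finset.Iio p = ∅ := by
          ext i
          simp only [Finset.mem_Iio, Fin.lt_def, Finset.notMem_empty, iff_false]
          omega
        rw [hA', this, h0]
        simp [ht]
      · have hq : ((p : ℕ)) = ((⟨p - 1, by omega⟩ : Fin (N + 1)) : ℕ) + 1 := by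
          simp only; omega
        have h1 := lt_countLE_of_strictMono hy ⟨p - 1, by omega⟩ t
        rw [hyi] at h1
        have h2 : A' = V ⟨p - 1, by omega⟩ := by
          simp only [hA', hV]
          rw [Iio_eq_Iic hq]
        rw [h2, ← h1]
        simp only
        omega
    · exact le_add_of_nonneg_right (mul_nonneg (hδpos' m).le hA'0)
    · rw [hyi, hVp]
      have := mul_pos (hδpos' m) (hE' p)
      linarith
    · intro t
      rw [← hp₁, lt_countLE_of_strictMono hy, hyi]
    · rw [← hyi p₁]
      exact hy hlt
    · rw [← hyi, ← hyi]
      exact hy.monotone hle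
    · rw [← hpk, lt_countLE_of_strictMono hy, hyi]
  have hdiff := squeeze_zero_norm (fun m => (Real.norm_eq_abs _).trans_le (hbound m)) herr
  have := hdiff.add hmain
  rw [zero_add] at this
  exact this.congr fun m => by ring

/-- Both members of the couple at position `p` of the increasing types `z.1` and `z.2` have a
nonzero gain from waiting, with the sign of `s`. Thus `s = -1` says that both strictly prefer
matching early. -/
def GainsHaveSign (s : ℝ) (k : ℕ) (P Q : Measure ℝ) {n : ℕ} (p : Fin n)
    (z : (Fin n → ℝ) × (Fin n → ℝ)) : Prop :=
  0 < s * (waitingPayoff k P Q z.1 z.2 p - z.2 p) ∧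
    0 < s * (waitingPayoff k Q P z.2 z.1 p - z.1 p)

theorem measurableSet_gainsHaveSign (s : ℝ) (k : ℕ) (P Q : Measure ℝ) [IsProbabilityMeasure P]
    [IsProbabilityMeasure Q] {n : ℕ} (p : Fin n) :
    MeasurableSet {z | GainsHaveSign s k P Q p z} := by
  have h1 := measurable_waitingPayoff k P Q p
  have h2 := (measurable_waitingPayoff k Q P p).comp measurable_swap
  exact (measurableSet_lt measurable_const ((h1.sub (by fun_prop)).const_mul s)).inter
    (measurableSet_lt measurable_const ((h2.sub (by fun_prop)).const_mul s))

theorem eventually_gain_pos_iff {u : ℕ → ℝ} {c l K s : ℝ} {n : ℕ → ℝ} (hn : ∀ m, 0 < n m)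
    (hc : 0 < c) (hK : 0 < K) (hs : s ≠ 0) (hl : l ≠ 0)
    (hu : Tendsto (fun m => n m ^ 2 * c * u m) atTop (𝓝 (K * l))) :
    ∀ᶠ m in atTop, (0 < s * u m ↔ 0 < s * l) := by
  have := eventually_pos_iff_of_tendsto (hu.const_mul s)
    (mul_ne_zero hs (mul_ne_zero hK.ne' hl))
  filter_upwards [this] with m hm
  have h1 : s * (n m ^ 2 * c * u m) = (n m ^ 2 * c) * (s * u m) := by ring
  have h2 : s * (K * l) = K * (s * l) := by ring
  have h3 : 0 < n m ^ 2 * c := mul_pos (pow_pos (hn m) 2) hc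
  rwa [h1, h2, mul_pos_iff_of_pos_left h3, mul_pos_iff_of_pos_left hK] at hm

/-- Along the scaled points, the signs of both gains are eventually those of the scaled gains, when
these do not vanish. -/
theorem eventually_gainsHaveSign_iff (hf : IsDensityOn f a b)
    (hfc : ContinuousWithinAt f (Icc a b) a) (hfa : 0 < f a) (hg : IsDensityOn g a' b')
    (hgc : ContinuousWithinAt g (Icc a' b') a') (hga : 0 < g a') {s : ℝ} (hs : s ≠ 0) {k : ℕ}
    (hk : 1 ≤ k) {N : ℕ} {p p₁ pk : Fin (N + 1)} (hp₁ : (p₁ : ℕ) = p + 1)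
    (hpk : (pk : ℕ) = p + k) {E E' : Fin (N + 1) → ℝ} (hE : ∀ i, 0 < E i) (hE' : ∀ i, 0 < E' i)
    (h1 : scaledGain (gapTriple p p₁ E') (gapTriple p p₁ E) ≠ 0)
    (h2 : scaledGain (gapTriple p p₁ E) (gapTriple p p₁ E') ≠ 0) :
    ∀ᶠ m in atTop, (GainsHaveSign s k (typeLaw f a b) (typeLaw g a' b') p
      (pointsOfGaps a (gapScale (f a) N m) E, pointsOfGaps a' (gapScale (g a') N m) E') ↔
      0 < s * scaledGain (gapTriple p p₁ E) (gapTriple p p₁ E') ∧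
        0 < s * scaledGain (gapTriple p p₁ E') (gapTriple p p₁ E)) := by
  have hk' : (0:ℝ) < k / 2 := by
    have : (0:ℝ) < k := by exact_mod_cast hk
    positivity
  have hn : ∀ m : ℕ, (0:ℝ) < ((N + 1 + m : ℕ) : ℝ) := fun m => by positivity
  have e1 := eventually_gain_pos_iff hn hga hk' hs h1
    (tendsto_waitingPayoff hf hfc hfa hg hgc hga k hp₁ hpk hk hE hE')
  have e2 := eventually_gain_pos_iff hn hfa hk' hs h2
    (tendsto_waitingPayoff hg hgc hga hf hfc hfa k hp₁ hpk hk hE' hE)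
  filter_upwards [e1, e2] with m h1 h2
  rw [GainsHaveSign, h1, h2, and_comm]

end PointwiseLimit

/-! ### The limit of the unraveling probabilities -/

section LimitLaw

theorem ae_expMeasure_pos : ∀ᵐ x ∂(expMeasure 1), 0 < x := by
  have h : expMeasure 1 (Iic 0) = 0 := by
    rw [← measure_congr (Iio_ae_eq_Iic (μ := expMeasure 1) (a := 0)), expMeasure, gammaMeasure,
      withDensity_apply _ measurableSet_Iio]
    exact lintegral_gammaPDF_of_nonpos le_rfl
  rw [ae_iff]
  convert h using 2
  ext x
  simp

/-- The law of `R` independent exponential gaps. -/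
noncomputable abbrev gapLaw (R : ℕ) : Measure (Fin R → ℝ) := Measure.pi fun _ => expMeasure 1

theorem ae_gapLaw_pos (R : ℕ) : ∀ᵐ E ∂(gapLaw R), ∀ i, 0 < E i :=
  ae_all_iff.2 fun i =>
    (measurePreserving_eval (fun _ : Fin R => expMeasure 1) i).quasiMeasurePreserving.ae
      ae_expMeasure_pos

theorem gapLaw_eq_withDensity (R : ℕ) :
    gapLaw R = volume.withDensity fun E : Fin R → ℝ => ∏ i, gammaPDF 1 1 (E i) := by
  have : SigmaFinite (volume.withDensity (gammaPDF 1 1)) :=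
    inferInstanceAs (SigmaFinite (expMeasure 1))
  exact pi_withDensity (measurable_gammaPDF 1 1)

theorem map_gapTriple {N : ℕ} {p p₁ : Fin (N + 1)} (hp₁ : (p₁ : ℕ) = p + 1) {r : ℕ}
    (hr : (p : ℕ) = r - 1) : (gapLaw (N + 1)).map (gapTriple p p₁) = tripleLaw r := by
  have hlt : p < p₁ := by rw [Fin.lt_def]; omega
  exact map_triple_eq_tripleLaw (μ := gapLaw (N + 1)) (X := fun i E => E i)
    (iIndepFun_pi (X := fun _ x => x) fun _ => aemeasurable_id) (fun i => measurable_pi_apply i)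
    (fun i => (measurePreserving_eval (fun _ : Fin (N + 1) => expMeasure 1) i).map_eq)
    (Finset.Iio p) (by simp) (by simpa using hlt.le) hlt.ne (by simpa using hr)

theorem ae_gapTriple_pos {N : ℕ} (p p₁ : Fin (N + 1)) :
    ∀ᵐ E ∂(gapLaw (N + 1)), 0 < (gapTriple p p₁ E).1 + (gapTriple p p₁ E).2.1 := by
  filter_upwards [ae_gapLaw_pos (N + 1)] with E hE
  have : 0 ≤ ∑ j ∈ Finset.Iio p, E j := Finset.sum_nonneg fun j _ => (hE j).le
  exact add_pos_of_nonneg_of_pos this (hE p)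

theorem measurableSet_scaledGain_ne_zero :
    MeasurableSet {z : (ℝ × ℝ × ℝ) × (ℝ × ℝ × ℝ) | scaledGain z.2 z.1 ≠ 0} :=
  (measurableSet_eq_fun (measurable_scaledGain.comp measurable_swap) measurable_const).compl

/-- Given everything but the gap `c`, at most one value of `c` makes the scaled gain vanish. -/
theorem ae_scaledGain_ne_zero (r : ℕ) {u : ℝ × ℝ × ℝ} (hu : 0 < u.1 + u.2.1) :
    ∀ᵐ t ∂(tripleLaw r), scaledGain t u ≠ 0 := by
  have hm : MeasurableSet {t : ℝ × ℝ × ℝ | scaledGain t u ≠ 0} :=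
    measurableSet_scaledGain_ne_zero.preimage (measurable_prodMk_left (x := u))
  rw [tripleLaw, Measure.ae_prod_iff_ae_ae hm]
  refine ae_of_all _ fun a => ?_
  have hm' : MeasurableSet {y : ℝ × ℝ | scaledGain (a, y) u ≠ 0} :=
    hm.preimage measurable_prodMk_left
  rw [Measure.ae_prod_iff_ae_ae hm']
  refine ae_of_all _ fun b => ?_
  have hne : ∀ᵐ c ∂(expMeasure 1), c ≠ ((2 * a + b) * b) / (2 * (u.1 + u.2.1)) := by
    rw [ae_iff]
    simp
  filter_upwards [hne] with c hc h0
  apply hc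
  rw [scaledGain] at h0
  rw [eq_div_iff (by positivity)]
  linarith

theorem ae_gaps_scaledGain_ne_zero {N : ℕ} {p p₁ : Fin (N + 1)} (hp₁ : (p₁ : ℕ) = p + 1) :
    ∀ᵐ z ∂((gapLaw (N + 1)).prod (gapLaw (N + 1))),
      scaledGain (gapTriple p p₁ z.2) (gapTriple p p₁ z.1) ≠ 0 := by
  have hT := measurable_gapTriple p p₁
  have hlaw := map_gapTriple (p := p) hp₁ (r := (p : ℕ) + 1) (by simp)
  have hpos : ∀ᵐ u ∂(tripleLaw ((p : ℕ) + 1)), 0 < u.1 + u.2.1 := by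
    rw [← hlaw, ae_map_iff hT.aemeasurable (measurableSet_lt measurable_const (by fun_prop))]
    exact ae_gapTriple_pos p p₁
  have h : ∀ᵐ z ∂((tripleLaw ((p : ℕ) + 1)).prod (tripleLaw ((p : ℕ) + 1))),
      scaledGain z.2 z.1 ≠ 0 := by
    rw [Measure.ae_prod_iff_ae_ae measurableSet_scaledGain_ne_zero]
    filter_upwards [hpos] with u hu using ae_scaledGain_ne_zero _ hu
  rw [← hlaw, Measure.map_prod_map _ _ hT hT] at h
  exact ae_of_ae_map (hT.prodMap hT).aemeasurable h

theorem measurableSet_gaps_scaledGain (s : ℝ) {N : ℕ} (p p₁ : Fin (N + 1)) :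
    MeasurableSet {z : (Fin (N + 1) → ℝ) × (Fin (N + 1) → ℝ) |
      0 < s * scaledGain (gapTriple p p₁ z.1) (gapTriple p p₁ z.2) ∧
        0 < s * scaledGain (gapTriple p p₁ z.2) (gapTriple p p₁ z.1)} :=
  ((measurable_gapTriple p p₁).prodMap (measurable_gapTriple p p₁)) (measurableSet_scaledGain s)

theorem limitProb_eq_gapLaw (s : ℝ) {N : ℕ} {p p₁ : Fin (N + 1)} (hp₁ : (p₁ : ℕ) = p + 1) {r : ℕ}
    (hr : (p : ℕ) = r - 1) : limitProb s r = ((gapLaw (N + 1)).prod (gapLaw (N + 1))).real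
      {z | 0 < s * scaledGain (gapTriple p p₁ z.1) (gapTriple p p₁ z.2) ∧
        0 < s * scaledGain (gapTriple p p₁ z.2) (gapTriple p p₁ z.1)} := by
  have hT := measurable_gapTriple p p₁
  rw [limitProb, ← map_gapTriple hp₁ hr, Measure.map_prod_map _ _ hT hT,
    map_measureReal_apply (by fun_prop) (measurableSet_scaledGain s)]
  rfl

end LimitLaw

section Convergence

variable {f g : ℝ → ℝ} {a b a' b' : ℝ}

/-- The probability that both gains from waiting of the couple at rank `i` have the sign of `s`.
With `s = -1` it is the unraveling probability; both signs are needed because reflection exchanges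
them. -/
noncomputable def signProb (s : ℝ) (k : ℕ) (F G : Measure ℝ) {n : ℕ} (i : Fin n) : ℝ :=
  ((Measure.pi fun _ : Fin n => F).prod (Measure.pi fun _ : Fin n => G)).real
    {t | 0 < s * (waitingPayoff k F G t.1 t.2 (Tuple.sort t.1 i) - t.2 (Tuple.sort t.2 i)) ∧
      0 < s * (waitingPayoff k G F t.2 t.1 (Tuple.sort t.2 i) - t.1 (Tuple.sort t.1 i))}

/-- Only the `R` lowest types of each side matter. -/
theorem signProb_eq_lowest (s : ℝ) (k : ℕ) (F G : Measure ℝ) [IsProbabilityMeasure F]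
    [IsProbabilityMeasure G] [NullSingletonClass F] [NullSingletonClass G] {R m : ℕ} (p : Fin R)
    (hp : (p : ℕ) + k < R) : signProb s k F G (Fin.castAdd m p) =
      (((Measure.pi fun _ : Fin (R + m) => F).map lowest).prod
        ((Measure.pi fun _ : Fin (R + m) => G).map (lowest (R := R)))).real
          {z | GainsHaveSign s k F G p z} := by
  have hl := measurable_lowest R m
  rw [Measure.map_prod_map _ _ hl hl, map_measureReal_apply (by fun_prop)
    (measurableSet_gainsHaveSign s k F G p), signProb]
  refine measureReal_congr ?_
  filter_upwards [Measure.quasiMeasurePreserving_fst.ae (ae_pi_injective F (R + m)),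
    Measure.quasiMeasurePreserving_snd.ae (ae_pi_injective G (R + m))] with t h1 h2
  refine propext ?_
  change _ ∧ _ ↔ GainsHaveSign s k F G p (Prod.map lowest lowest t)
  rw [waitingPayoff_lowest k F G t.2 h1 p hp, waitingPayoff_lowest k G F t.1 h2 p hp]
  rfl

/-- The probability that both gains from waiting of the `r`-th lowest couple have a given sign
converges to the probability that both scaled gains have that sign. -/
theorem tendsto_signProb (hf : IsDensityOn f a b)
    (hfc : ContinuousWithinAt f (Icc a b) a) (hfa : 0 < f a) (hg : IsDensityOn g a' b')
    (hgc : ContinuousWithinAt g (Icc a' b') a') (hga : 0 < g a') {s : ℝ} (hs : s ≠ 0) {k : ℕ}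
    (hk : 1 ≤ k) (r N : ℕ) {p p₁ pk : Fin (N + 1)} (hr : (p : ℕ) = r - 1)
    (hp₁ : (p₁ : ℕ) = p + 1) (hpk : (pk : ℕ) = p + k) :
    Tendsto (fun m => signProb s k (typeLaw f a b) (typeLaw g a' b') (Fin.castAdd m p)) atTop
      (𝓝 (limitProb s r)) := by
  have := hf.isProbabilityMeasure
  have := hg.isProbabilityMeasure
  have hfP : IsProbabilityMeasure (volume.withDensity (typeDensity f a b)) := by
    rwa [← typeLaw_eq_withDensity]
  have hgP : IsProbabilityMeasure (volume.withDensity (typeDensity g a' b')) := by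
    rwa [← typeLaw_eq_withDensity]
  have hfm := hf.measurable_typeDensity
  have hgm := hg.measurable_typeDensity
  set δ := gapScale (f a) N
  set δ' := gapScale (g a') N
  have hδ : ∀ m, 0 < δ m := gapScale_pos hfa N
  have hδ' : ∀ m, 0 < δ' m := gapScale_pos hga N
  set d : ℕ → (Fin (N + 1) → ℝ) → ℝ≥0∞ := fun m => gapDensity (typeDensity f a b) a (δ m) N m
  set d' : ℕ → (Fin (N + 1) → ℝ) → ℝ≥0∞ := fun m => gapDensity (typeDensity g a' b') a' (δ' m) N m
  set e : (Fin (N + 1) → ℝ) → ℝ≥0∞ := fun E => ∏ i, gammaPDF 1 1 (E i)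
  have hdm : ∀ m, Measurable (d m) := fun m => measurable_gapDensity hfm _ _ _ _
  have hdm' : ∀ m, Measurable (d' m) := fun m => measurable_gapDensity hgm _ _ _ _
  have hem : Measurable e := Finset.measurable_prod _ fun i _ =>
    (measurable_gammaPDF 1 1).comp (measurable_pi_apply i)
  have hmap : ∀ m, (volume.withDensity (d m)).map (pointsOfGaps a (δ m)) =
      (Measure.pi fun _ : Fin (N + 1 + m) => typeLaw f a b).map lowest := fun m => by
    simp only [d, typeLaw_eq_withDensity]
    exact map_pointsOfGaps_gapDensity hfm a (hδ m) N m
  have hmap' : ∀ m, (volume.withDensity (d' m)).map (pointsOfGaps a' (δ' m)) =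
      (Measure.pi fun _ : Fin (N + 1 + m) => typeLaw g a' b').map lowest := fun m => by
    simp only [d', typeLaw_eq_withDensity]
    exact map_pointsOfGaps_gapDensity hgm a' (hδ' m) N m
  have hdP : ∀ m, IsProbabilityMeasure (volume.withDensity (d m)) := fun m => by
    have h1 := Measure.isProbabilityMeasure_map
      (μ := Measure.pi fun _ : Fin (N + 1 + m) => typeLaw f a b)
      (measurable_lowest (N + 1) m).aemeasurable
    rw [← hmap m] at h1
    exact Measure.isProbabilityMeasure_of_map (pointsOfGaps a (δ m))
  have hdP' : ∀ m, IsProbabilityMeasure (volume.withDensity (d' m)) := fun m => by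
    have h1 := Measure.isProbabilityMeasure_map
      (μ := Measure.pi fun _ : Fin (N + 1 + m) => typeLaw g a' b')
      (measurable_lowest (N + 1) m).aemeasurable
    rw [← hmap' m] at h1
    exact Measure.isProbabilityMeasure_of_map (pointsOfGaps a' (δ' m))
  have hpoints : ∀ m, Measurable
      (Prod.map (pointsOfGaps (R := N + 1) a (δ m)) (pointsOfGaps (R := N + 1) a' (δ' m))) :=
    fun m => (measurable_pointsOfGaps a (δ m)).prodMap (measurable_pointsOfGaps a' (δ' m))
  have hq : ∀ m, signProb s k (typeLaw f a b) (typeLaw g a' b') (Fin.castAdd m p) =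
      ((volume.withDensity (d m)).prod (volume.withDensity (d' m))).real
        (Prod.map (pointsOfGaps a (δ m)) (pointsOfGaps a' (δ' m)) ⁻¹'
          {z | GainsHaveSign s k (typeLaw f a b) (typeLaw g a' b') p z}) := fun m => by
    rw [signProb_eq_lowest s k _ _ p (by have := pk.isLt; omega), ← hmap, ← hmap',
      Measure.map_prod_map _ _ (measurable_pointsOfGaps a (δ m))
        (measurable_pointsOfGaps a' (δ' m)),
      map_measureReal_apply (hpoints m) (measurableSet_gainsHaveSign s k _ _ p)]
  rw [funext hq]
  have hB := measurableSet_gaps_scaledGain s p p₁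
  have hAB : ∀ᵐ z ∂((gapLaw (N + 1)).prod (gapLaw (N + 1))), ∀ᶠ m in atTop,
      (GainsHaveSign s k (typeLaw f a b) (typeLaw g a' b') p
        (pointsOfGaps a (δ m) z.1, pointsOfGaps a' (δ' m) z.2) ↔
      0 < s * scaledGain (gapTriple p p₁ z.1) (gapTriple p p₁ z.2) ∧
        0 < s * scaledGain (gapTriple p p₁ z.2) (gapTriple p p₁ z.1)) := by
    have h1 := ae_gaps_scaledGain_ne_zero hp₁
    have h2 : ∀ᵐ z ∂((gapLaw (N + 1)).prod (gapLaw (N + 1))),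
        scaledGain (gapTriple p p₁ z.1) (gapTriple p p₁ z.2) ≠ 0 :=
      Measure.measurePreserving_swap.quasiMeasurePreserving.ae h1
    have h3 : ∀ᵐ z ∂((gapLaw (N + 1)).prod (gapLaw (N + 1))), ∀ i, 0 < z.1 i :=
      Measure.quasiMeasurePreserving_fst.ae (ae_gapLaw_pos (N + 1))
    have h4 : ∀ᵐ z ∂((gapLaw (N + 1)).prod (gapLaw (N + 1))), ∀ i, 0 < z.2 i :=
      Measure.quasiMeasurePreserving_snd.ae (ae_gapLaw_pos (N + 1))
    filter_upwards [h3, h4, h1, h2] with z hz hz' h1 h2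
    exact eventually_gainsHaveSign_iff hf hfc hfa hg hgc hga hs hk hp₁ hpk hz hz' h1 h2
  have hlim : ∀ᵐ E ∂(gapLaw (N + 1)), Tendsto (fun m => d m E) atTop (𝓝 (e E)) :=
    (ae_gapLaw_pos (N + 1)).mono fun E hE => hf.tendsto_gapDensity hfc hfa N hE
  have hlim' : ∀ᵐ E ∂(gapLaw (N + 1)), Tendsto (fun m => d' m E) atTop (𝓝 (e E)) :=
    (ae_gapLaw_pos (N + 1)).mono fun E hE => hg.tendsto_gapDensity hgc hga N hE
  have het : ∀ E, e E ≠ ∞ := fun E => ENNReal.prod_ne_top fun i _ => ENNReal.ofReal_ne_top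
  have heP : IsProbabilityMeasure (volume.withDensity e) := by
    rw [← gapLaw_eq_withDensity]; infer_instance
  rw [limitProb_eq_gapLaw s hp₁ hr]
  rw [gapLaw_eq_withDensity] at hAB hlim hlim' ⊢
  exact tendsto_measureReal_prod_withDensity hdm hdm' hem hem het het hlim hlim'
    (fun m => (measurableSet_gainsHaveSign s k _ _ p).preimage (hpoints m)) hB hAB

end Convergence

section Reflection

theorem IsDensityOn.comp_neg {f : ℝ → ℝ} {a b : ℝ} (hf : IsDensityOn f a b) :
    IsDensityOn (fun x => f (-x)) (-b) (-a) where
  measurable := hf.measurable.comp measurable_neg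
  nonneg x hx := hf.nonneg _ ⟨by linarith [hx.2], by linarith [hx.1]⟩
  lintegral_eq_one := by
    have h := (Measure.measurePreserving_neg (volume : Measure ℝ)).setLIntegral_comp_preimage
      (measurableSet_Icc (a := a) (b := b)) hf.measurable.ennreal_ofReal
    rw [hf.lintegral_eq_one] at h
    rw [← h]
    congr 2
    simp

theorem map_neg_typeLaw {f : ℝ → ℝ} {a b : ℝ} (hf : IsDensityOn f a b) :
    (typeLaw f a b).map Neg.neg = typeLaw (fun x => f (-x)) (-b) (-a) := by
  ext s hs
  rw [Measure.map_apply measurable_neg hs, typeLaw, typeLaw,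
    withDensity_apply _ (measurable_neg hs), withDensity_apply _ hs,
    Measure.restrict_restrict (measurable_neg hs), Measure.restrict_restrict hs]
  have h := (Measure.measurePreserving_neg (volume : Measure ℝ)).setLIntegral_comp_preimage
    ((measurable_neg hs).inter (measurableSet_Icc (a := a) (b := b))) hf.measurable.ennreal_ofReal
  rw [← h]
  congr 2
  ext x
  simp [and_comm]

/-- Reflection exchanges the lowest and the highest couples and the sign of the gains. -/
theorem signProb_map_neg (s : ℝ) (k : ℕ) (P Q : Measure ℝ) [IsProbabilityMeasure P]
    [IsProbabilityMeasure Q] [NullSingletonClass P] [NullSingletonClass Q] {n : ℕ} (i : Fin n) :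
    signProb s k (P.map Neg.neg) (Q.map Neg.neg) i = signProb (-s) k P Q i.rev := by
  have hmp := (pi_map_neg P n).prod (pi_map_neg Q n)
  have hme : MeasurableEmbedding (Prod.map (fun x : Fin n → ℝ => -x) fun x : Fin n → ℝ => -x) :=
    ((MeasurableEquiv.neg (Fin n → ℝ)).prodCongr
      (MeasurableEquiv.neg (Fin n → ℝ))).measurableEmbedding
  rw [signProb, signProb, measureReal_def, measureReal_def, ← hmp.measure_preimage_emb hme]
  congr 1
  refine measure_congr ?_
  filter_upwards [Measure.quasiMeasurePreserving_fst.ae (ae_pi_injective P n),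
    Measure.quasiMeasurePreserving_snd.ae (ae_pi_injective Q n)] with t h1 h2
  refine propext ?_
  change (_ ∧ _) ↔ (_ ∧ _)
  simp only [Prod.map_fst, Prod.map_snd]
  rw [waitingPayoff_neg k P Q h1 h2, waitingPayoff_neg k Q P h2 h1, sort_neg h1, sort_neg h2]
  simp only [Equiv.trans_apply, Fin.revPerm_apply, Pi.neg_apply]
  refine and_congr ?_ ?_ <;>
  · refine iff_of_eq (congr_arg _ ?_)
    ring

end Reflection

section Unraveling

theorem unravelProb_eq_signProb (k : ℕ) (F G : Measure ℝ) {j n : ℕ} (h1 : 1 ≤ j) (i : Fin n)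
    (hi : (i : ℕ) = j - 1) : unravelProb k F G j n = signProb (-1) k F G i := by
  have hj : 1 ≤ j ∧ j ≤ n := ⟨h1, by have := i.isLt; omega⟩
  rw [unravelProb, dif_pos hj, signProb]
  have : (⟨j - 1, by omega⟩ : Fin n) = i := Fin.ext hi.symm
  rw [this]
  congr 1
  ext t
  simp [CoupleWantsEarly]

variable {f g : ℝ → ℝ} {a b a' b' : ℝ}

theorem tendsto_unravelProb_lowest {k : ℕ} (hk : 1 ≤ k) (hf : IsDensityOn f a b)
    (hg : IsDensityOn g a' b') (hfc : ContinuousWithinAt f (Icc a b) a) (hfa : 0 < f a)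
    (hgc : ContinuousWithinAt g (Icc a' b') a') (hga : 0 < g a') {r : ℕ} (hr : 1 ≤ r) :
    Tendsto (fun n => unravelProb k (typeLaw f a b) (typeLaw g a' b') r n) atTop
      (𝓝 (limitProb (-1) r)) := by
  set N := r - 1 + k with hN
  rw [← tendsto_add_atTop_iff_nat (N + 1)]
  refine (tendsto_signProb hf hfc hfa hg hgc hga (s := -1) (by norm_num) hk r N
    (p := ⟨r - 1, by omega⟩) (p₁ := ⟨r - 1 + 1, by omega⟩) (pk := ⟨r - 1 + k, by omega⟩)
    rfl rfl rfl).congr fun m => ?_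
  rw [add_comm m (N + 1)]
  exact (unravelProb_eq_signProb k _ _ hr _ rfl).symm

theorem tendsto_unravelProb_highest {k : ℕ} (hk : 1 ≤ k) (hf : IsDensityOn f a b)
    (hg : IsDensityOn g a' b') (hfc : ContinuousWithinAt f (Icc a b) b) (hfb : 0 < f b)
    (hgc : ContinuousWithinAt g (Icc a' b') b') (hgb : 0 < g b') {r : ℕ} (hr : 1 ≤ r) :
    Tendsto (fun n => unravelProb k (typeLaw f a b) (typeLaw g a' b') (n + 1 - r) n) atTop
      (𝓝 (limitProb 1 r)) := by
  have := hf.isProbabilityMeasure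
  have := hg.isProbabilityMeasure
  have hcont : ∀ {f : ℝ → ℝ} {a b : ℝ}, ContinuousWithinAt f (Icc a b) b →
      ContinuousWithinAt (fun x => f (-x)) (Icc (-b) (-a)) (-b) := by
    intro f a b h
    have h' : ContinuousWithinAt f (Icc a b) (-(-b)) := by rwa [neg_neg]
    exact h'.comp continuous_neg.continuousWithinAt
      fun x hx => ⟨by linarith [hx.2], by linarith [hx.1]⟩
  set N := r - 1 + k with hN
  rw [← tendsto_add_atTop_iff_nat (N + 1)]
  refine (tendsto_signProb hf.comp_neg (hcont hfc) (by simpa using hfb) hg.comp_neg (hcont hgc)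
    (by simpa using hgb) (s := 1) one_ne_zero hk r N
    (p := ⟨r - 1, by omega⟩) (p₁ := ⟨r - 1 + 1, by omega⟩) (pk := ⟨r - 1 + k, by omega⟩)
    rfl rfl rfl).congr fun m => ?_
  rw [← map_neg_typeLaw hf, ← map_neg_typeLaw hg, signProb_map_neg, add_comm m (N + 1)]
  refine (unravelProb_eq_signProb k _ _ (by omega) _ ?_).symm
  simp only [Fin.val_rev, Fin.val_castAdd]
  omega

end Unraveling

end MatchingMarket

theorem proposition2 (k : ℕ) (hk : 1 ≤ k)
    (f g : ℝ → ℝ) (mlo mhi wlo whi : ℝ)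
    (hf : MatchingMarket.IsDensityOn f mlo mhi) (hg : MatchingMarket.IsDensityOn g wlo whi) :
    ((ContinuousWithinAt f (Icc mlo mhi) mhi ∧ 0 < f mhi ∧
        ContinuousWithinAt g (Icc wlo whi) whi ∧ 0 < g whi) →
      ∀ r : ℕ, 1 ≤ r →
        Tendsto (fun n : ℕ => MatchingMarket.unravelProb k
            (MatchingMarket.typeLaw f mlo mhi) (MatchingMarket.typeLaw g wlo whi) (n + 1 - r) n)
          atTop (𝓝 (MatchingMarket.zeta r)) ∧ 0 < MatchingMarket.zeta r) ∧
    ((ContinuousWithinAt f (Icc mlo mhi) mlo ∧ 0 < f mlo ∧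
        ContinuousWithinAt g (Icc wlo whi) wlo ∧ 0 < g wlo) →
      ∀ r : ℕ, 1 ≤ r →
        Tendsto (fun n : ℕ => MatchingMarket.unravelProb k
            (MatchingMarket.typeLaw f mlo mhi) (MatchingMarket.typeLaw g wlo whi) r n)
          atTop (𝓝 (MatchingMarket.eta r)) ∧ 0 < MatchingMarket.eta r) ∧
    Tendsto MatchingMarket.zeta atTop (𝓝 (1 / 4)) ∧
    Tendsto MatchingMarket.eta atTop (𝓝 (1 / 4)) := by
  rw [MatchingMarket.zeta_eq_limitProb, MatchingMarket.eta_eq_limitProb]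
  refine ⟨fun ⟨h1, h2, h3, h4⟩ r hr => ⟨?_, ?_⟩, fun ⟨h1, h2, h3, h4⟩ r hr => ⟨?_, ?_⟩,
    MatchingMarket.tendsto_limitProb one_ne_zero,
    MatchingMarket.tendsto_limitProb (neg_ne_zero.2 one_ne_zero)⟩
  · exact MatchingMarket.tendsto_unravelProb_highest hk hf hg h1 h2 h3 h4 hr
  · exact MatchingMarket.limitProb_pos (Or.inl rfl) r
  · exact MatchingMarket.tendsto_unravelProb_lowest hk hf hg h1 h2 h3 h4 hr
  · exact MatchingMarket.limitProb_pos (Or.inr rfl) r
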